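/- Let $n\in\mathbb N$ and let $\mathfrak g=\mathfrak{su}(n)$ (skew-Hermitian traceless complex $n\times n$ matrices) carry the inner product $\langle X,Y\rangle_{\mathfrak g}=\operatorname{Tr}X^*Y$; give $\mathfrak g\otimes\mathfrak g$ the induced inner product norm. *Littlewood–Paley operators.* Let $\rho_0:\mathbb R^2\to[0,\infty)$ be a radial $C^\infty$ function supported in $\{\tfrac67\le|\xi|\le2\}$ with $\rho_0(\xi)=1$ for $1\le|\xi|\le\tfrac{12}7$ and $\rho_0(\xi)+\rho_0(\xi/2)=1$ for $1\le|\xi|\le\tfrac{24}7$. Put $\rho_j(\xi)=\rho_0(2^{-j}\xi)$ for $j\ge0$, and $\rho_{-1}(\xi)=\sum_{i\le-1}\rho_0(2^{-i}\xi)$ for $\xi\ne0$, $\rho_{-1}(0)=1$. Let $\check\rho_j(x)=(2\pi)^{-2}\int_{\mathbb R^2}e^{i\langle\xi,x\rangle}\rho_j(\xi)\,d\xi$, $\Delta_ju=\check\rho_j*u$, and $\mathbf S_ju=\sum_{i=-1}^{j-1}\Delta_iu$ for $j\ge-1$ (so $\mathbf S_{-1}=0$). *Curves.* Let $\mathfrak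 C$ be the set of smooth $\mathbf c=(\mathbf c_1,\mathbf c_2):\mathbb R\to\mathbb R^2$ with $\operatorname{supp}\dot{\mathbf c}\subset[0,1]$ and $\mathbf c_1(t)>0$ for all $t$. For $\mathbf c\in\mathfrak C$ and $h\in L^\infty(\mathbb R)$ let $\mathcal E_{\mathbf c}h\in L^2(\mathbb R^2)$ be the function determined by $$\langle H,\mathcal E_{\mathbf c}h\rangle_{L^2(\mathbb R^2)}=\int_{\mathbb R}\int_0^{\mathbf c_1(t)}H(x_1,\mathbf c_2(t))\,h(t)\,\dot{\mathbf c}_2(t)\,dx_1\,dt\qquad\text{for all }H\in L^2(\mathbb R^2),$$ and let $\mathfrak C_\infty$ be the set of $\mathbf c\in\mathfrak C$ with $\sup\{\|\mathcal E_{\mathbf c}h\|_{L^\infty(\mathbb R^2)}:\|h\|_{L^\infty(\mathbb R)}\le1\}<\infty$. *The process.* Let $W$ be a $\mathfrak g$-valued white noise on $\mathbb R^2$ over a probability space $(\Omega,\mathbb P)$, i.e. a centred jointly Gaussian family of $\mathfrak g$-valued random variables $W(f)$, linear in $f\in L^2(\mathbb R^2)$, with $\mathbb E[\langle W(f),X\rangle_{\mathfrak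 g}\langle W(g),Y\rangle_{\mathfrak g}]=\langle f,g\rangle_{L^2(\mathbb R^2)}\langle X,Y\rangle_{\mathfrak g}$ for all $f,g\in L^2(\mathbb R^2)$ and $X,Y\in\mathfrak g$, whose restriction to $\mathcal S(\mathbb R^2)$ is realized by a tempered distribution $W_\omega\in\mathcal S'(\mathbb R^2,\mathfrak g)$ for every $\omega\in\Omega$. Let $W^{(j)}=\mathbf S_jW$, let $$X^{(j)}_t=\int_0^t\Bigl(\int_0^{\mathbf c_1(r)}W^{(j)}(x_1,\mathbf c_2(r))\,dx_1\Bigr)\dot{\mathbf c}_2(r)\,dr$$ be the line integral along $\mathbf c|_{[0,t]}$ of the axial gauge field $A^{(j)}=\bigl(\int_0^{x_1}W^{(j)}(\xi,x_2)\,d\xi\bigr)dx_2$, and let $$\mathbb X^{(j)}_{s,t}=\int_s^t\bigl(X^{(j)}_r-X^{(j)}_s\bigr)\otimes\dot X^{(j)}_r\,dr\in\mathfrak g\otimes\mathfrak g .$$ **Proposition 9.5.** For any $\mathbf c\in\mathfrak C_\infty$ and $p\in[1,\infty)$ there exists $C=C(\mathbf c,p)>0$ (depending also on the fixed $n$ and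 $\rho_0$, but not on $(\Omega,\mathbb P)$ or $W$) such that for all $j\ge-1$ and $0\le s<t\le1$, $\mathbb X^{(j)}_{s,t}\in L^p(\mathbb P,\mathfrak g\otimes\mathfrak g)$ and $$\bigl\|\mathbb X^{(j)}_{s,t}\bigr\|_{L^p(\mathbb P,\,\mathfrak g\otimes\mathfrak g)}\le C\,(t-s).$$ -/

import Mathlib

open MeasureTheory ProbabilityTheory
open scoped ENNReal SchwartzMap FourierTransform TensorProduct

noncomputable section

namespace YM2

/-- The Euclidean plane; `x 0` and `x 1` are the first and the second coordinate. -/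
abbrev Plane : Type := EuclideanSpace ℝ (Fin 2)

/-! ### The Lie algebra `su(n)` with the Hilbert–Schmidt inner product -/

/-- Skew-Hermitian traceless matrices, as a real subspace of the complex `n × n` matrices. -/
def suSubmodule (n : ℕ) : Submodule ℝ (Matrix (Fin n) (Fin n) ℂ) where
  carrier := {M | M.conjTranspose = -M ∧ M.trace = 0}
  add_mem' := by
    rintro A B ⟨hA, hA'⟩ ⟨hB, hB'⟩
    refine ⟨?_, ?_⟩
    · rw [Matrix.conjTranspose_add, hA, hB]; abel
    · rw [Matrix.trace_add, hA', hB', add_zero]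
  zero_mem' := by simp
  smul_mem' := by
    rintro r A ⟨hA, hA'⟩
    refine ⟨?_, ?_⟩
    · rw [Matrix.conjTranspose_smul, hA]; simp
    · rw [Matrix.trace_smul, hA', smul_zero]

/-- The Lie algebra `su(n)`, as a type of its own, so that its topology is the one of the
Hilbert–Schmidt norm introduced below. -/
def su (n : ℕ) : Type := suSubmodule n

instance (n : ℕ) : AddCommGroup (su n) := inferInstanceAs (AddCommGroup (suSubmodule n))
instance (n : ℕ) : Module ℝ (su n) := inferInstanceAs (Module ℝ (suSubmodule n))
instance (n : ℕ) : FiniteDimensional ℝ (su n) :=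
  inferInstanceAs (FiniteDimensional ℝ (suSubmodule n))

/-- The matrix underlying an element of `su(n)`. -/
def su.mat {n : ℕ} : su n →ₗ[ℝ] Matrix (Fin n) (Fin n) ℂ := (suSubmodule n).subtype

/-- The Hilbert–Schmidt inner product `Tr (X* Y)`; on `su(n)` this trace is real. -/
abbrev suCore (n : ℕ) : InnerProductSpace.Core ℝ (su n) where
  inner X Y := (((su.mat X).conjTranspose * su.mat Y).trace).re
  conj_inner_symm X Y := by
    have h : ((su.mat X).conjTranspose * su.mat Y).trace
        = star (((su.mat Y).conjTranspose * su.mat X).trace) := by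
      rw [← Matrix.trace_conjTranspose, Matrix.conjTranspose_mul,
        Matrix.conjTranspose_conjTranspose]
    simp [h]
  re_inner_nonneg X := by
    change 0 ≤ (((su.mat X).conjTranspose * su.mat X).trace).re
    simp only [Matrix.trace, Matrix.diag, Matrix.mul_apply, Matrix.conjTranspose_apply,
      Complex.re_sum]
    refine Finset.sum_nonneg fun i _ => Finset.sum_nonneg fun j _ => ?_
    simp only [RCLike.star_def, Complex.mul_re, Complex.conj_re, Complex.conj_im]
    nlinarith [sq_nonneg (su.mat X j i).re, sq_nonneg (su.mat X j i).im]
  add_left X Y Z := by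
    simp [Matrix.conjTranspose_add, add_mul, Matrix.trace_add]
  smul_left X Y r := by
    simp [Matrix.conjTranspose_smul, Matrix.trace_smul]
  definite X h := by
    simp only [Matrix.trace, Matrix.diag, Matrix.mul_apply, Matrix.conjTranspose_apply,
      Complex.re_sum] at h
    have hn : ∀ i j : Fin n, 0 ≤ (star (su.mat X j i) * su.mat X j i).re := fun i j => by
      simp only [RCLike.star_def, Complex.mul_re, Complex.conj_re, Complex.conj_im]
      nlinarith [sq_nonneg (su.mat X j i).re, sq_nonneg (su.mat X j i).im]
    have h0 : su.mat X = 0 := by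
      ext j i
      have h1 := (Finset.sum_eq_zero_iff_of_nonneg
        (fun i _ => Finset.sum_nonneg (s := Finset.univ) fun j _ => hn i j)).1 h i (Finset.mem_univ _)
      have h2 := (Finset.sum_eq_zero_iff_of_nonneg (fun j _ => hn i j)).1 h1 j
        (Finset.mem_univ _)
      have h3 : (((su.mat X j i).re) ^ 2 + ((su.mat X j i).im) ^ 2) = 0 := by
        rw [← h2]
        simp only [RCLike.star_def, Complex.mul_re, Complex.conj_re, Complex.conj_im]
        ring
      have h4 : (su.mat X j i).re = 0 := by nlinarith [sq_nonneg (su.mat X j i).im]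
      have h5 : (su.mat X j i).im = 0 := by nlinarith [sq_nonneg (su.mat X j i).re]
      exact Complex.ext h4 h5
    exact Subtype.ext h0

instance (n : ℕ) : NormedAddCommGroup (su n) := (suCore n).toNormedAddCommGroup
instance (n : ℕ) : InnerProductSpace ℝ (su n) := .ofCore (suCore n).toCore
instance (n : ℕ) : MeasurableSpace (su n) := borel (su n)
instance (n : ℕ) : BorelSpace (su n) := ⟨rfl⟩

/-! ### Littlewood–Paley operators -/

/-- A function `ρ₀` generating the dyadic partition of unity: radial, smooth, nonnegative,
supported in `6/7 ≤ |ξ| ≤ 2`, with `ρ₀ = 1` on `1 ≤ |ξ| ≤ 12/7` and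
`ρ₀(ξ) + ρ₀(ξ/2) = 1` on `1 ≤ |ξ| ≤ 24/7`. -/
structure DyadicGenerator where
  /-- the function `ρ₀` -/
  fn : Plane → ℝ
  radial : ∀ ξ η : Plane, ‖ξ‖ = ‖η‖ → fn ξ = fn η
  smooth : ContDiff ℝ (⊤ : ℕ∞) fn
  nonneg : ∀ ξ, 0 ≤ fn ξ
  supp : tsupport fn ⊆ {ξ | 1 - 1 / 7 ≤ ‖ξ‖ ∧ ‖ξ‖ ≤ 2}
  eq_one : ∀ ξ, 1 ≤ ‖ξ‖ → ‖ξ‖ ≤ 2 - 2 / 7 → fn ξ = 1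
  add_eq_one : ∀ ξ, 1 ≤ ‖ξ‖ → ‖ξ‖ ≤ 4 - 4 / 7 → fn ξ + fn ((1 / 2 : ℝ) • ξ) = 1

namespace DyadicGenerator

variable (ρ : DyadicGenerator)

/-- The low frequency cutoff `χ₀(ξ) = ∑_{j ≤ -1} ρ₀(2^{-j} ξ)` for `ξ ≠ 0` (with `j = -(k+1)`),
and `χ₀(0) = 1`. -/
def low (ξ : Plane) : ℝ :=
  open Classical in if ξ = 0 then 1 else ∑' k : ℕ, ρ.fn ((2 : ℝ) ^ (k + 1) • ξ)

/-- The symbol `ρ_i` of the `i`-th Littlewood–Paley block, `i ≥ -1`: `ρ_{-1} = χ₀` and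
`ρ_i(ξ) = ρ₀(2^{-i} ξ)` for `i ≥ 0`. -/
def symbol (i : ℤ) (ξ : Plane) : ℝ :=
  if i = -1 then ρ.low ξ else ρ.fn ((2 : ℝ) ^ (-i) • ξ)

theorem fn_eq_zero_of_two_lt {ξ : Plane} (h : 2 < ‖ξ‖) : ρ.fn ξ = 0 := by
  by_contra hne
  exact absurd (ρ.supp (subset_tsupport _ hne)).2 (not_le.2 h)

theorem fn_eq_zero_of_lt {ξ : Plane} (h : ‖ξ‖ < 6 / 7) : ρ.fn ξ = 0 := by
  by_contra hne
  have := (ρ.supp (subset_tsupport _ hne)).1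
  linarith

theorem fn_eq_zero_of_two_le {ξ : Plane} (h : 2 ≤ ‖ξ‖) : ρ.fn ξ = 0 := by
  rcases h.lt_or_eq with h | h
  · exact ρ.fn_eq_zero_of_two_lt h
  · have h1 := ρ.add_eq_one ξ (by rw [← h]; norm_num) (by rw [← h]; norm_num)
    have hn : ‖(1 / 2 : ℝ) • ξ‖ = 1 := by
      rw [norm_smul, ← h, Real.norm_eq_abs, abs_of_pos (by norm_num)]; norm_num
    have h2 := ρ.eq_one ((1 / 2 : ℝ) • ξ) (by rw [hn]) (by rw [hn]; norm_num)
    linarith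

theorem norm_pow_smul (k : ℕ) (ξ : Plane) : ‖(2 : ℝ) ^ k • ξ‖ = 2 ^ k * ‖ξ‖ := by
  rw [norm_smul, Real.norm_eq_abs, abs_of_pos (by positivity)]

theorem low_of_quarter_lt {ξ : Plane} (h : 1 / 4 < ‖ξ‖) :
    ρ.low ξ = ρ.fn ((2 : ℝ) • ξ) + ρ.fn ((4 : ℝ) • ξ) := by
  have h0 : ξ ≠ 0 := by rintro rfl; simp at h; linarith
  rw [low, if_neg h0, tsum_eq_sum (s := Finset.range 2)]
  · simp [Finset.sum_range_succ]; norm_num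
  · intro k hk
    apply ρ.fn_eq_zero_of_two_lt
    have hk : 2 ≤ k := by simpa [Nat.succ_le_iff] using hk
    rw [norm_pow_smul]
    have : (2 : ℝ) ^ 3 ≤ 2 ^ (k + 1) := pow_le_pow_right₀ (by norm_num) (by omega)
    nlinarith

theorem low_of_lt_half {ξ : Plane} (h : ‖ξ‖ < 1 / 2) : ρ.low ξ = 1 := by
  by_cases h0 : ξ = 0
  · simp [low, h0]
  have hpos : 0 < ‖ξ‖ := norm_pos_iff.2 h0
  have hex : ∃ m : ℕ, 1 ≤ 2 ^ m * ‖ξ‖ := by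
    obtain ⟨m, hm⟩ := pow_unbounded_of_one_lt (‖ξ‖⁻¹) (by norm_num : (1 : ℝ) < 2)
    refine ⟨m, ?_⟩
    have := mul_le_mul_of_nonneg_right hm.le hpos.le
    rwa [inv_mul_cancel₀ hpos.ne'] at this
  classical
  let m := Nat.find hex
  have hm : 1 ≤ 2 ^ m * ‖ξ‖ := Nat.find_spec hex
  have hm' : ∀ k < m, 2 ^ k * ‖ξ‖ < 1 := fun k hk => not_le.1 (Nat.find_min hex hk)
  have hm2 : 2 ≤ m := by
    by_contra hlt
    have : (2 : ℝ) ^ m ≤ 2 ^ 1 := pow_le_pow_right₀ (by norm_num) (by omega)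
    nlinarith
  obtain ⟨q, hq⟩ : ∃ q, m = q + 2 := ⟨m - 2, by omega⟩
  have hlt := hm' (q + 1) (by omega)
  rw [hq] at hm
  rw [low, if_neg h0, tsum_eq_sum (s := {q, q + 1})]
  · rw [Finset.sum_pair (by omega)]
    have h1 := ρ.add_eq_one ((2 : ℝ) ^ (q + 2) • ξ) (by rwa [norm_pow_smul])
      (by rw [norm_pow_smul, pow_succ]; linarith)
    have h2 : (1 / 2 : ℝ) • (2 : ℝ) ^ (q + 2) • ξ = (2 : ℝ) ^ (q + 1) • ξ := by
      rw [smul_smul]; congr 1; rw [pow_succ _ (q + 1)]; ring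
    rw [h2] at h1
    rw [add_comm]; exact h1
  · intro k hk
    simp only [Finset.mem_insert, Finset.mem_singleton, not_or] at hk
    rcases lt_or_ge k q with hkq | hkq
    · apply ρ.fn_eq_zero_of_lt
      rw [norm_pow_smul]
      have : (2 : ℝ) ^ (k + 1) ≤ 2 ^ q := pow_le_pow_right₀ (by norm_num) (by omega)
      rw [pow_succ] at hlt
      nlinarith
    · apply ρ.fn_eq_zero_of_two_le
      rw [norm_pow_smul]
      have : (2 : ℝ) ^ (q + 2 + 1) ≤ 2 ^ (k + 1) := pow_le_pow_right₀ (by norm_num) (by omega)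
      rw [pow_succ] at this
      nlinarith

theorem low_of_one_lt {ξ : Plane} (h : 1 < ‖ξ‖) : ρ.low ξ = 0 := by
  rw [ρ.low_of_quarter_lt (by linarith), ρ.fn_eq_zero_of_two_lt, ρ.fn_eq_zero_of_two_lt, add_zero]
  · rw [norm_smul, Real.norm_eq_abs, abs_of_pos (by norm_num)]; linarith
  · rw [norm_smul, Real.norm_eq_abs, abs_of_pos (by norm_num)]; linarith

theorem contDiff_low : ContDiff ℝ (⊤ : ℕ∞) ρ.low := by
  rw [contDiff_iff_contDiffAt]
  intro ξ
  rcases lt_or_ge ‖ξ‖ (1 / 2) with h | h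
  · have : ρ.low =ᶠ[nhds ξ] fun _ => 1 := by
      filter_upwards [(isOpen_lt continuous_norm continuous_const).mem_nhds h] with η hη
      exact ρ.low_of_lt_half hη
    exact contDiffAt_const.congr_of_eventuallyEq this
  · have : ρ.low =ᶠ[nhds ξ] fun η => ρ.fn ((2 : ℝ) • η) + ρ.fn ((4 : ℝ) • η) := by
      have h' : 1 / 4 < ‖ξ‖ := by linarith
      filter_upwards [(isOpen_lt continuous_const continuous_norm).mem_nhds h'] with η hη
      exact ρ.low_of_quarter_lt hη
    refine ContDiffAt.congr_of_eventuallyEq ?_ this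
    exact ((ρ.smooth.comp (contDiff_const_smul (2 : ℝ))).add
      (ρ.smooth.comp (contDiff_const_smul (4 : ℝ)))).contDiffAt

theorem hasCompactSupport_low : HasCompactSupport ρ.low :=
  HasCompactSupport.intro (isCompact_closedBall (0 : Plane) 1) fun ξ hξ =>
    ρ.low_of_one_lt (by simpa using hξ)

theorem contDiff_symbol (i : ℤ) : ContDiff ℝ (⊤ : ℕ∞) (ρ.symbol i) := by
  unfold symbol
  split_ifs
  · exact ρ.contDiff_low
  · exact ρ.smooth.comp (contDiff_const_smul _)

theorem hasCompactSupport_fn : HasCompactSupport ρ.fn :=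
  HasCompactSupport.intro (isCompact_closedBall (0 : Plane) 2) fun ξ hξ =>
    ρ.fn_eq_zero_of_two_lt (by simpa using hξ)

theorem hasCompactSupport_symbol (i : ℤ) : HasCompactSupport (ρ.symbol i) := by
  unfold symbol
  split_ifs
  · exact ρ.hasCompactSupport_low
  · exact ρ.hasCompactSupport_fn.comp_smul (zpow_ne_zero _ two_ne_zero)

theorem symbol_neg (i : ℤ) (ξ : Plane) : ρ.symbol i (-ξ) = ρ.symbol i ξ := by
  have h : ∀ a : ℝ, ρ.fn (a • -ξ) = ρ.fn (a • ξ) := fun a =>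
    ρ.radial _ _ (by rw [smul_neg, norm_neg])
  simp only [symbol, low, h, neg_eq_zero]

/-- The symbol `ρ_i`, as a Schwartz function in the frequency variable `w = ξ / 2π` of Mathlib's
Fourier transform. -/
def symbolSchwartz (i : ℤ) : 𝓢(Plane, ℂ) :=
  HasCompactSupport.toSchwartzMap (f := fun w => (ρ.symbol i ((2 * Real.pi) • w) : ℂ))
    (((ρ.hasCompactSupport_symbol i).comp_smul (by positivity)).comp_left Complex.ofReal_zero)
    (Complex.ofRealCLM.contDiff.comp
      ((ρ.contDiff_symbol i).comp (contDiff_const_smul (2 * Real.pi))))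

/-- The convolution kernel `ρ̌_i` of the Littlewood–Paley block `Δ_i`, i.e.
`(2π)⁻² ∫ exp(i⟨ξ, x⟩) ρ_i(ξ) dξ`, which is real since `ρ_i` is real and even. -/
def blockKernel (i : ℤ) : 𝓢(Plane, ℝ) :=
  SchwartzMap.postcompCLM Complex.reCLM (𝓕⁻ (ρ.symbolSchwartz i))

theorem blockKernel_apply (i : ℤ) (x : Plane) :
    (ρ.blockKernel i x : ℂ) = ((2 * Real.pi) ^ 2 : ℝ)⁻¹ •
      ∫ ξ : Plane, Complex.exp (Complex.I * (inner ℝ ξ x : ℝ)) * (ρ.symbol i ξ : ℂ) := by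
  have key : 𝓕⁻ (ρ.symbolSchwartz i) x = ((2 * Real.pi) ^ 2 : ℝ)⁻¹ •
      ∫ ξ : Plane, Complex.exp (Complex.I * (inner ℝ ξ x : ℝ)) * (ρ.symbol i ξ : ℂ) := by
    rw [SchwartzMap.fourierInv_coe, Real.fourierInv_eq']
    have := Measure.integral_comp_smul (volume : Measure Plane)
      (fun ξ : Plane => Complex.exp (Complex.I * (inner ℝ ξ x : ℝ)) * (ρ.symbol i ξ : ℂ))
      (2 * Real.pi)
    rw [finrank_euclideanSpace_fin, abs_of_pos (by positivity)] at this
    rw [← this]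
    refine integral_congr_ae (Filter.Eventually.of_forall fun w => ?_)
    simp only [symbolSchwartz, smul_eq_mul, inner_smul_left]
    congr 2
    simp
    ring
  rw [← key]
  change (((𝓕⁻ (ρ.symbolSchwartz i) x).re : ℝ) : ℂ) = _
  rw [← Complex.conj_eq_iff_re, key, Complex.real_smul, map_mul, Complex.conj_ofReal,
    ← integral_conj]
  congr 1
  rw [← integral_neg_eq_self]
  refine integral_congr_ae (Filter.Eventually.of_forall fun ξ => ?_)
  simp [symbol_neg, ← Complex.exp_conj]

/-- The convolution kernel of `S_j = ∑_{-1 ≤ i ≤ j - 1} Δ_i` (an empty sum for `j = -1`). -/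
def kernel (j : ℤ) : 𝓢(Plane, ℝ) := ∑ i ∈ Finset.Ico (-1) j, ρ.blockKernel i

end DyadicGenerator

/-- The Schwartz function `y ↦ K (x - y)`. -/
def reflectShift (K : 𝓢(Plane, ℝ)) (x : Plane) : 𝓢(Plane, ℝ) :=
  SchwartzMap.compSubConstCLM ℝ x
    (SchwartzMap.compCLMOfContinuousLinearEquiv ℝ (ContinuousLinearEquiv.neg ℝ) K)

theorem reflectShift_apply (K : 𝓢(Plane, ℝ)) (x y : Plane) :
    reflectShift K x y = K (x - y) := by
  simp [reflectShift]

/-! ### White noise -/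

section Field

variable {V : Type*} [NormedAddCommGroup V] [InnerProductSpace ℝ V] [MeasurableSpace V]

/-- A `V`-valued white noise on the plane: a centred Gaussian family `W(f)`, `f ∈ L²(ℝ²)`, of
`V`-valued random variables, linear in `f`, with
`𝔼 (⟨W(f), X⟩ ⟨W(g), Y⟩) = ⟨f, g⟩ ⟨X, Y⟩`, together with a realization
`W_ω ∈ 𝓢'(ℝ², V)`, for every `ω`, of its restriction to Schwartz functions. -/
structure WhiteNoise (V : Type*) [NormedAddCommGroup V] [InnerProductSpace ℝ V]
    [MeasurableSpace V] {Ω : Type*} [MeasurableSpace Ω] (P : Measure Ω) where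
  /-- the `L²` random variable `W(f)` -/
  toFun : Lp ℝ 2 (volume : Measure Plane) →ₗ[ℝ] Lp V 2 P
  gaussian : IsGaussianProcess (fun f ω => toFun f ω) P
  centered : ∀ f, ∫ ω, toFun f ω ∂P = 0
  covariance : ∀ (f g : Lp ℝ 2 (volume : Measure Plane)) (X Y : V),
    ∫ ω, inner ℝ (toFun f ω) X * inner ℝ (toFun g ω) Y ∂P = inner ℝ f g * inner ℝ X Y
  /-- the tempered distribution `W_ω` -/
  dist : Ω → 𝓢(Plane, ℝ) →L[ℝ] V
  dist_ae_eq : ∀ φ : 𝓢(Plane, ℝ), (fun ω => dist ω φ) =ᵐ[P] toFun (φ.toLp 2 volume)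

/-- The convolution `K * T` of a tempered distribution `T` with a Schwartz function `K`, as the
function `x ↦ T(K(x - ·))`. -/
def convolve (T : 𝓢(Plane, ℝ) →L[ℝ] V) (K : 𝓢(Plane, ℝ)) (x : Plane) : V :=
  T (reflectShift K x)

/-- The second component `A₂(x) = ∫_0^{x₁} F(ξ, x₂) dξ` of the gauge field with curvature `F` in
axial gauge; the first component vanishes. -/
def axialPotential (F : Plane → V) (x : Plane) : V :=
  ∫ ξ in (0 : ℝ)..(x 0), F !₂[ξ, x 1]

/-- The line integral of the 1-form `A₁ dx₁ + A₂ dx₂` along the restriction of `c` to `[0, t]`. -/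
def lineIntegral (c : ℝ → Plane) (A₁ A₂ : Plane → V) (t : ℝ) : V :=
  ∫ r in (0 : ℝ)..t, (deriv (fun u => c u 0) r • A₁ (c r) + deriv (fun u => c u 1) r • A₂ (c r))

/-- The `j`-th smooth approximation `W^{(j)} = S_j W` of the white noise. -/
def WhiteNoise.approx {Ω : Type*} [MeasurableSpace Ω] {P : Measure Ω} (W : WhiteNoise V P)
    (ρ : DyadicGenerator) (j : ℤ) (ω : Ω) : Plane → V :=
  convolve (W.dist ω) (ρ.kernel j)

/-- The process `X^{(j)}_t`, the line integral along `c` restricted to `[0, t]` of the axial gauge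
field with curvature `W^{(j)}`. -/
def WhiteNoise.path {Ω : Type*} [MeasurableSpace Ω] {P : Measure Ω} (W : WhiteNoise V P)
    (ρ : DyadicGenerator) (c : ℝ → Plane) (j : ℤ) (ω : Ω) : ℝ → V :=
  lineIntegral c 0 (axialPotential (W.approx ρ j ω))

/-- The second level `∫_s^t (x_r - x_s) ⊗ x'_r dr` of the signature of a smooth path `x`. -/
def secondLevel (x : ℝ → V) (s t : ℝ) : V ⊗[ℝ] V :=
  ∫ r in s..t, (x r - x s) ⊗ₜ[ℝ] deriv x r

end Field

/-! ### Curves and the operator `ℰ_c` -/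

/-- Smooth curves in the half plane `x₁ > 0` that are constant on `(-∞, 0]` and on `[1, ∞)`. -/
structure IsCurve (c : ℝ → Plane) : Prop where
  smooth : ContDiff ℝ (⊤ : ℕ∞) c
  supp : tsupport (deriv c) ⊆ Set.Icc 0 1
  pos : ∀ t, 0 < c t 0

/-- The pairing `∫_ℝ ∫_0^{c₁(t)} H(x₁, c₂(t)) h(t) c₂'(t) dx₁ dt`. -/
def curvePairing (c : ℝ → Plane) (H : Plane → ℝ) (h : ℝ → ℝ) : ℝ :=
  ∫ t, ∫ x in (0 : ℝ)..(c t 0), H !₂[x, c t 1] * h t * deriv (fun u => c u 1) t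

/-- `u = ℰ_c h`: `u ∈ L²(ℝ²)` and `⟨H, u⟩ = ∫∫ H(x₁, c₂(t)) h(t) c₂'(t) dx₁ dt` for all
`H ∈ L²(ℝ²)`. This determines `u` almost everywhere. -/
def RepresentsCurve (c : ℝ → Plane) (h : ℝ → ℝ) (u : Plane → ℝ) : Prop :=
  MemLp u 2 volume ∧
    ∀ H : Plane → ℝ, MemLp H 2 volume → ∫ x, H x * u x = curvePairing c H h

/-- The operator `ℰ_c`: a representative of the element of `L²(ℝ²)` described in
`RepresentsCurve`. -/
def curveOp (c : ℝ → Plane) (h : ℝ → ℝ) : Plane → ℝ :=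
  open Classical in if hu : ∃ u, RepresentsCurve c h u then hu.choose else 0

/-- `‖ℰ_c‖_{∞∞}`, the supremum of `‖ℰ_c h‖_{L^∞}` over `h ∈ L^∞(ℝ)` with `‖h‖_{L^∞} ≤ 1`. -/
def curveOpNorm (c : ℝ → Plane) : ℝ≥0∞ :=
  ⨆ (h : ℝ → ℝ) (_ : AEStronglyMeasurable h volume) (_ : eLpNorm h ∞ volume ≤ 1),
    eLpNorm (curveOp c h) ∞ volume

end YM2

end

set_option linter.unusedSectionVars false

/-! Every increment of the path is white noise applied to a deterministic element of `L²(ℝ²)`: on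
`[u, v]` it is `W(incr c K u v)`, where `incr` is a smoothed version of `ℰ_c 1_{[u,v]}`
(`path_sub_ae_eq`). The deterministic heart is an energy bound, uniform in the cutoff and in the
partition: `‖∑ a_k incr_k‖² ≤ C ∑ a_k² |cell_k|`. On step functions `h`, it says that the smoothed
`ℰ_c h` is controlled in `L²(ℝ²)` by the `L²` norm of `h`.

Two facts produce it. Finiteness of `‖ℰ_c‖_{∞∞}` forces the image of `|c₂'| dt` under `c₂` to have
bounded density (`exists_occupation_le`). The kernels of the `S_j` are dilations of one Schwartz
function, hence bounded in `L¹` (`kernel_apply`). Pairing the sum with itself and absorbing half of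
its squared norm then gives `energy_le`.

The probabilistic part works in an orthonormal basis of the Lie algebra, whose components of the
noise are independent. A diagonal coordinate of the second level is half the square of a Gaussian
increment with variance at most `C (t - s)`. An off-diagonal coordinate is a limit of left point
sums `∑ W_e(g_k) W_f(incr_k)`. Given the `e`-component, such a sum is Gaussian with variance `‖∑
W_e(g_k) incr_k‖² ≤ C · mesh · ∑ W_e(g_k)²`, and each `W_e(g_k)` has variance at most `C (t - s)`.
Both kinds of coordinate therefore have moments of the size of powers of `t - s`, with constants
made of Gaussian moments only. The bound survives the limit of the sums, and finitely many
coordinates are added up. -/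

namespace YM2

open Filter Topology
open scoped NNReal

/-! ### Riemann sums -/

/-- The `k`-th node of the partition of `[s, t]` into `N` intervals of equal length. -/
noncomputable def node (s t : ℝ) (N k : ℕ) : ℝ := s + k * ((t - s) / N)

theorem node_zero (s t : ℝ) (N : ℕ) : node s t N 0 = s := by simp [node]

theorem node_last (s t : ℝ) {N : ℕ} (hN : N ≠ 0) : node s t N N = t := by
  have : (N : ℝ) ≠ 0 := by exact_mod_cast hN
  simp only [node]; field_simp; ring

theorem node_succ_sub (s t : ℝ) (N k : ℕ) :
    node s t N (k + 1) - node s t N k = (t - s) / N := by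
  simp only [node]; push_cast; ring

theorem node_le_succ {s t : ℝ} (h : s ≤ t) (N k : ℕ) : node s t N k ≤ node s t N (k + 1) := by
  have := node_succ_sub s t N k
  have : 0 ≤ (t - s) / N := div_nonneg (by linarith) (by positivity)
  linarith

theorem le_node {s t : ℝ} (h : s ≤ t) (N k : ℕ) : s ≤ node s t N k := by
  have : 0 ≤ (t - s) / N := div_nonneg (by linarith) (by positivity)
  simp only [node]; nlinarith [mul_nonneg (Nat.cast_nonneg (α := ℝ) k) this]

theorem node_le {s t : ℝ} (h : s ≤ t) {N k : ℕ} (hk : k ≤ N) : node s t N k ≤ t := by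
  rcases Nat.eq_zero_or_pos N with rfl | hN
  · obtain rfl : k = 0 := by omega
    simpa [node] using h
  · have h1 := node_last s t hN.ne'
    have : 0 ≤ (t - s) / N := div_nonneg (by linarith) (by positivity)
    have hk' : (k : ℝ) ≤ N := by exact_mod_cast hk
    simp only [node] at h1 ⊢; nlinarith [mul_le_mul_of_nonneg_right hk' this]

/-- The weight `g` is integrated exactly and only `f` is frozen at the left node, so the error on a
cell is at most `sup |g|` times the oscillation of `f` times the mesh. With `g = 1` this
approximates integrals in `L²`; with `g` a velocity, the exact integrals are increments of the path.
-/
theorem tendsto_riemann_sum {E : Type*} [NormedAddCommGroup E] [NormedSpace ℝ E]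
    [CompleteSpace E] {f : ℝ → E} {g : ℝ → ℝ} (hf : Continuous f) (hg : Continuous g)
    {s t : ℝ} (hst : s ≤ t) :
    Tendsto (fun N : ℕ => ∑ k ∈ Finset.range N,
        (∫ r in (node s t N k)..(node s t N (k + 1)), g r) • f (node s t N k)) atTop
      (𝓝 (∫ r in s..t, g r • f r)) := by
  obtain ⟨B, hB⟩ := isCompact_Icc.exists_bound_of_continuousOn (s := Set.Icc s t) hg.continuousOn
  have hB0 : 0 ≤ B := (norm_nonneg _).trans (hB s ⟨le_rfl, hst⟩)
  have huc := isCompact_Icc.uniformContinuousOn_of_continuous (s := Set.Icc s t) hf.continuousOn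
  rw [Metric.uniformContinuousOn_iff_le] at huc
  rw [Metric.tendsto_atTop]
  intro ε hε
  have hpos : 0 < B * (t - s) + 1 := by nlinarith
  -- The total error is `B (t - s)` times the oscillation, so this tolerance leaves less than `ε`;
  -- the `+ 1` prevents division by zero when `B` or `t - s` vanishes.
  obtain ⟨δ, hδ, H⟩ := huc (ε / (2 * (B * (t - s) + 1))) (by positivity)
  obtain ⟨N₀, hN₀⟩ := exists_nat_gt ((t - s) / δ)
  refine ⟨N₀ + 1, fun N hN => ?_⟩
  have hN0 : N ≠ 0 := by omega
  have hNp : (0 : ℝ) < N := by positivity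
  have hmesh : (t - s) / N ≤ δ := by
    have h1 : (N₀ : ℝ) ≤ N := by exact_mod_cast (by omega : N₀ ≤ N)
    rw [div_lt_iff₀ hδ] at hN₀
    rw [div_le_iff₀ hNp]
    nlinarith
  have hint : Continuous fun r => g r • f r := hg.smul hf
  have e1 : ∫ r in s..t, g r • f r = ∑ k ∈ Finset.range N,
      ∫ r in (node s t N k)..(node s t N (k + 1)), g r • f r := by
    rw [intervalIntegral.sum_integral_adjacent_intervals
      (fun k _ => hint.intervalIntegrable _ _), node_zero, node_last s t hN0]
  rw [e1, dist_eq_norm, ← Finset.sum_sub_distrib]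
  have key : ∀ k ∈ Finset.range N,
      ‖(∫ r in (node s t N k)..(node s t N (k + 1)), g r) • f (node s t N k) -
        ∫ r in (node s t N k)..(node s t N (k + 1)), g r • f r‖
        ≤ (B * (ε / (2 * (B * (t - s) + 1)))) * ((t - s) / N) := by
    intro k hk
    have hkN : k < N := Finset.mem_range.1 hk
    rw [← intervalIntegral.integral_smul_const,
      ← intervalIntegral.integral_sub ((by fun_prop : Continuous fun r => g r • f (node s t N k)).intervalIntegrable _ _)
        (hint.intervalIntegrable _ _)]
    have := intervalIntegral.norm_integral_le_of_norm_le_const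
      (a := node s t N k) (b := node s t N (k + 1))
      (f := fun r => g r • f (node s t N k) - g r • f r)
      (C := B * (ε / (2 * (B * (t - s) + 1)))) ?_
    · rwa [node_succ_sub, abs_of_nonneg (div_nonneg (by linarith) hNp.le)] at this
    · intro r hr
      rw [Set.uIoc_of_le (node_le_succ hst N k)] at hr
      have h1 := le_node hst N k
      have h2 := node_le hst (show k + 1 ≤ N by omega)
      have hrm : r ∈ Set.Icc s t := ⟨by linarith [hr.1], by linarith [hr.2]⟩
      rw [← smul_sub, norm_smul]
      refine mul_le_mul (hB r hrm) ?_ (norm_nonneg _) hB0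
      rw [← dist_eq_norm]
      refine H _ ⟨h1, node_le hst hkN.le⟩ _ hrm ?_
      have := node_succ_sub s t N k
      rw [Real.dist_eq, abs_sub_comm, abs_of_nonneg (by linarith [hr.1])]
      linarith [hr.2]
  refine (norm_sum_le_of_le _ key).trans_lt ?_
  rw [Finset.sum_const, Finset.card_range, nsmul_eq_mul]
  have : (N : ℝ) * (B * (ε / (2 * (B * (t - s) + 1))) * ((t - s) / N))
      = ε * (B * (t - s) / (2 * (B * (t - s) + 1))) := by field_simp
  rw [this]
  have h3 : B * (t - s) / (2 * (B * (t - s) + 1)) < 1 := by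
    rw [div_lt_one (by positivity)]; nlinarith [mul_nonneg hB0 (sub_nonneg.2 hst)]
  nlinarith

/-- Pathwise integrals of a continuous process agree almost surely with the Bochner integral in
`L²` of the corresponding curve. -/
theorem integral_ae_eq_integral_Lp {Ω V : Type*} [MeasurableSpace Ω] {P : Measure Ω}
    [IsFiniteMeasure P] [NormedAddCommGroup V] [NormedSpace ℝ V] [CompleteSpace V]
    {u : ℝ → Ω → V} {U : ℝ → Lp V 2 P} (hu : ∀ ω, Continuous fun r => u r ω)
    (hU : Continuous U) (h : ∀ r, u r =ᵐ[P] U r) {s t : ℝ} (hst : s ≤ t) :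
    (fun ω => ∫ r in s..t, u r ω) =ᵐ[P] (∫ r in s..t, U r : Lp V 2 P) := by
  have hL := tendsto_riemann_sum hU (continuous_const (y := (1 : ℝ))) hst
  simp only [one_smul] at hL
  -- Convergence in `L²` yields almost sure convergence along a subsequence only. This suffices,
  -- because the pathwise sums converge along the whole sequence for every `ω`.
  obtain ⟨ns, hns, hae⟩ :=
    (tendstoInMeasure_of_tendsto_Lp hL).exists_seq_tendsto_ae
  have hsum : ∀ N : ℕ, (∑ k ∈ Finset.range N,
      (∫ _ in (node s t N k)..(node s t N (k + 1)), (1 : ℝ)) • U (node s t N k) : Lp V 2 P)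
      =ᵐ[P] fun ω => ∑ k ∈ Finset.range N,
      (∫ _ in (node s t N k)..(node s t N (k + 1)), (1 : ℝ)) • u (node s t N k) ω := by
    intro N
    have h1 : ∀ k, ∀ᵐ ω ∂P, ((∫ _ in (node s t N k)..(node s t N (k + 1)), (1 : ℝ)) •
        U (node s t N k) : Lp V 2 P) ω =
        (∫ _ in (node s t N k)..(node s t N (k + 1)), (1 : ℝ)) • u (node s t N k) ω := by
      intro k
      filter_upwards [Lp.coeFn_smul (∫ _ in (node s t N k)..(node s t N (k + 1)), (1 : ℝ))
        (U (node s t N k)), h (node s t N k)] with ω h1 h2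
      rw [h1, Pi.smul_apply, h2]
    refine (Lp.coeFn_finsetSum _ _).trans ?_
    filter_upwards [ae_all_iff.2 h1] with ω hω
    simp only [Finset.sum_apply]
    exact Finset.sum_congr rfl fun k _ => hω k
  filter_upwards [hae, ae_all_iff.2 hsum] with ω h1 h2
  have h3 := (tendsto_riemann_sum (hu ω) (continuous_const (y := (1 : ℝ))) hst).comp
    hns.tendsto_atTop
  simp only [one_smul] at h3
  refine tendsto_nhds_unique h3 (h1.congr fun i => ?_)
  exact h2 (ns i)

/-! ### Translations of Schwartz functions -/

/-- Mean value inequality on the segment from `x` to `x - h`. Since `‖h‖ ≤ 1`, the weights `1 + ‖w‖`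
on the segment are comparable to `1 + ‖x‖` up to a factor 2, which costs one `2 ^ k`; the other
comes from bounding `(1 + ‖w‖) ^ k` by seminorms. -/
theorem seminorm_translate_sub_le {E F : Type*} [NormedAddCommGroup E] [NormedSpace ℝ E]
    [NormedAddCommGroup F] [NormedSpace ℝ F] (f : 𝓢(E, F)) (k l : ℕ) {h : E} (hh : ‖h‖ ≤ 1) :
    SchwartzMap.seminorm ℝ k l (SchwartzMap.compSubConstCLM ℝ h f - f) ≤
      2 ^ k * (2 ^ k * (Finset.Iic (k, l + 1)).sup
        (fun m => SchwartzMap.seminorm ℝ (E := E) (F := F) m.1 m.2) f) * ‖h‖ := by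
  set S := (Finset.Iic (k, l + 1)).sup
        (fun m => SchwartzMap.seminorm ℝ (E := E) (F := F) m.1 m.2) f with hS
  have hS0 : 0 ≤ S := apply_nonneg _ _
  refine SchwartzMap.seminorm_le_bound ℝ k l _ (by positivity) fun x => ?_
  have e : ⇑(SchwartzMap.compSubConstCLM ℝ h f - f) = (fun z => f (z - h)) - ⇑f := by
    ext z; simp
  have hsm : ContDiff ℝ (l : ℕ∞) f := f.smooth _
  rw [e, iteratedFDeriv_sub_apply
    (f := fun z => f (z - h))
    ((hsm.comp (contDiff_id.sub contDiff_const)).contDiffAt) hsm.contDiffAt,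
    iteratedFDeriv_comp_sub]
  have hmv : ‖iteratedFDeriv ℝ l f (x - h) - iteratedFDeriv ℝ l f x‖ ≤
      (2 ^ k * (2 ^ k * S) / (1 + ‖x‖) ^ k) * ‖x - h - x‖ := by
    refine Convex.norm_image_sub_le_of_norm_fderiv_le (𝕜 := ℝ) (s := segment ℝ x (x - h))
      ?_ ?_ (convex_segment _ _) (left_mem_segment ℝ _ _) (right_mem_segment ℝ _ _)
    · intro w _
      exact ((f.smooth (⊤ : ℕ∞)).differentiable_iteratedFDeriv
        (by exact_mod_cast WithTop.coe_lt_top _)) w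
    · intro w hw
      rw [norm_fderiv_iteratedFDeriv]
      have h1 := SchwartzMap.one_add_le_sup_seminorm_apply (𝕜 := ℝ) (m := (k, l + 1))
        (le_refl k) (le_refl (l + 1)) f w
      have h2 : 1 + ‖x‖ ≤ 2 * (1 + ‖w‖) := by
        have : ‖x - w‖ ≤ ‖h‖ := by
          have := norm_sub_le_of_mem_segment hw
          rw [norm_sub_rev] at this
          simpa using this
        have := norm_le_norm_add_norm_sub' x w
        linarith [norm_nonneg w]
      have h3 : (1 + ‖x‖) ^ k ≤ 2 ^ k * (1 + ‖w‖) ^ k := by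
        rw [← mul_pow]; exact pow_le_pow_left₀ (by positivity) h2 k
      rw [le_div_iff₀ (by positivity)]
      calc ‖iteratedFDeriv ℝ (l + 1) f w‖ * (1 + ‖x‖) ^ k
          ≤ ‖iteratedFDeriv ℝ (l + 1) f w‖ * (2 ^ k * (1 + ‖w‖) ^ k) := by gcongr
        _ = 2 ^ k * ((1 + ‖w‖) ^ k * ‖iteratedFDeriv ℝ (l + 1) f w‖) := by ring
        _ ≤ _ := by gcongr
  have hx : ‖x‖ ^ k ≤ (1 + ‖x‖) ^ k := pow_le_pow_left₀ (norm_nonneg _) (by linarith) k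
  calc ‖x‖ ^ k * ‖iteratedFDeriv ℝ l f (x - h) - iteratedFDeriv ℝ l f x‖
      ≤ (1 + ‖x‖) ^ k * ((2 ^ k * (2 ^ k * S) / (1 + ‖x‖) ^ k) * ‖x - h - x‖) := by gcongr
    _ = _ := by
      have : (1 + ‖x‖) ^ k ≠ 0 := by positivity
      rw [show x - h - x = -h by abel, norm_neg]
      field_simp

/-- Translations compose additively, so continuity at the origin is enough. This makes both `x ↦
W_ω(K(x - ·))` and the curve `x ↦ K(x - ·)` in `L²` continuous. -/
theorem continuous_compSubConst {E F : Type*} [NormedAddCommGroup E] [NormedSpace ℝ E]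
    [NormedAddCommGroup F] [NormedSpace ℝ F] (f : 𝓢(E, F)) :
    Continuous fun x : E => SchwartzMap.compSubConstCLM ℝ x f := by
  have h0 : ∀ g : 𝓢(E, F), Tendsto (fun h : E => SchwartzMap.compSubConstCLM ℝ h g)
      (𝓝 0) (𝓝 g) := by
    intro g
    rw [(schwartz_withSeminorms ℝ E F).tendsto_nhds]
    rintro ⟨k, l⟩ ε hε
    set C := 2 ^ k * (2 ^ k * (Finset.Iic (k, l + 1)).sup
        (fun m => SchwartzMap.seminorm ℝ (E := E) (F := F) m.1 m.2) g) with hC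
    have hlim : Tendsto (fun h : E => C * ‖h‖) (𝓝 0) (𝓝 0) := by
      have : Continuous fun h : E => C * ‖h‖ := by fun_prop
      simpa using this.tendsto 0
    filter_upwards [hlim.eventually (gt_mem_nhds hε),
      Metric.closedBall_mem_nhds (0 : E) one_pos] with h h1 h2
    exact (seminorm_translate_sub_le g k l (by simpa using h2)).trans_lt h1
  rw [continuous_iff_continuousAt]
  intro x
  have h1 : Tendsto (fun y : E => y - x) (𝓝 x) (𝓝 0) := by
    have : Continuous fun y : E => y - x := by fun_prop
    simpa using this.tendsto x
  refine ((h0 (SchwartzMap.compSubConstCLM ℝ x f)).comp h1).congr fun y => ?_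
  simp [SchwartzMap.compSubConstCLM_comp]

theorem continuous_reflectShift (K : 𝓢(Plane, ℝ)) : Continuous (reflectShift K) :=
  continuous_compSubConst _

/-! ### The kernels of the low frequency projections -/

namespace DyadicGenerator

variable (ρ : DyadicGenerator)

/-- Halving the argument shifts the dyadic series by one term; this is what makes the sum of the
symbols telescope. -/
theorem low_half (ξ : Plane) : ρ.low ((1 / 2 : ℝ) • ξ) = ρ.low ξ + ρ.fn ξ := by
  by_cases h : ξ = 0
  · subst h
    rw [smul_zero, ρ.fn_eq_zero_of_lt (by simp), add_zero]
  have h' : (1 / 2 : ℝ) • ξ ≠ 0 := smul_ne_zero (by norm_num) h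
  rw [low, low, if_neg h, if_neg h']
  have e : ∀ k : ℕ, (2 : ℝ) ^ (k + 1) • (1 / 2 : ℝ) • ξ = (2 : ℝ) ^ k • ξ := fun k => by
    rw [smul_smul]; congr 1; rw [pow_succ]; ring
  simp only [e]
  have hs : Summable fun k : ℕ => ρ.fn ((2 : ℝ) ^ k • ξ) := by
    obtain ⟨m, hm⟩ := pow_unbounded_of_one_lt (2 * ‖ξ‖⁻¹) (by norm_num : (1 : ℝ) < 2)
    refine summable_of_ne_finset_zero (s := Finset.range m) fun k hk => ?_
    have hk : m ≤ k := by simpa using hk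
    apply ρ.fn_eq_zero_of_two_lt
    rw [norm_pow_smul]
    have hξ : 0 < ‖ξ‖ := norm_pos_iff.2 h
    have h1 : (2 : ℝ) ^ m ≤ 2 ^ k := pow_le_pow_right₀ (by norm_num) hk
    have h2 := mul_lt_mul_of_pos_right (hm.trans_le h1) hξ
    rwa [mul_assoc, inv_mul_cancel₀ hξ.ne', mul_one] at h2
  rw [hs.tsum_eq_zero_add]
  simp [add_comm]

theorem sum_symbol (j : ℕ) (ξ : Plane) :
    ∑ i ∈ Finset.Ico (-1 : ℤ) j, ρ.symbol i ξ = ρ.low ((2 : ℝ) ^ (-(j : ℤ)) • ξ) := by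
  induction j with
  | zero =>
    have : Finset.Ico (-1 : ℤ) ((0 : ℕ) : ℤ) = {-1} := rfl
    rw [this]; simp [symbol]
  | succ j ih =>
    have : Finset.Ico (-1 : ℤ) ((j + 1 : ℕ) : ℤ) = insert (j : ℤ) (Finset.Ico (-1 : ℤ) j) := by
      ext x; simp only [Finset.mem_insert, Finset.mem_Ico]; push_cast; omega
    rw [this, Finset.sum_insert (by simp), ih]
    have e : (2 : ℝ) ^ (-((j + 1 : ℕ) : ℤ)) • ξ = (1 / 2 : ℝ) • (2 : ℝ) ^ (-(j : ℤ)) • ξ := by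
      rw [smul_smul]; congr 1
      rw [show -((j + 1 : ℕ) : ℤ) = -1 + -(j : ℤ) by push_cast; ring, zpow_add₀ two_ne_zero]
      norm_num
    rw [e, low_half, symbol, if_neg (by omega), add_comm]

/-- The symbols below level `j` telescope to `low (2^{-j} ξ)`, and a dilation on the frequency side
is an inverse dilation in space, with Jacobian `(2^j)² = 4^j`. This scaling preserves the `L¹` norm.
-/
theorem kernel_apply (j : ℕ) (x : Plane) :
    ρ.kernel j x = (4 : ℝ) ^ j * ρ.blockKernel (-1) ((2 : ℝ) ^ j • x) := by
  have hint : ∀ i, Integrable fun ξ : Plane =>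
      Complex.exp (Complex.I * (inner ℝ ξ x : ℝ)) * (ρ.symbol i ξ : ℂ) := by
    intro i
    refine Continuous.integrable_of_hasCompactSupport ?_ ?_
    · have := (ρ.contDiff_symbol i).continuous
      fun_prop
    · exact ((ρ.hasCompactSupport_symbol i).comp_left Complex.ofReal_zero).mul_left
  have h1 : (ρ.kernel j x : ℂ) = ((2 * Real.pi) ^ 2 : ℝ)⁻¹ •
      ∫ ξ : Plane, Complex.exp (Complex.I * (inner ℝ ξ x : ℝ)) *
        (ρ.low ((2 : ℝ) ^ (-(j : ℤ)) • ξ) : ℂ) := by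
    have : ρ.kernel j x = ∑ i ∈ Finset.Ico (-1 : ℤ) j, ρ.blockKernel i x := by
      simp [kernel]
    rw [this]
    push_cast
    simp only [blockKernel_apply, ← sum_symbol]
    rw [← Finset.smul_sum, ← integral_finsetSum _ fun i _ => hint i]
    simp only [Complex.ofReal_sum, Finset.mul_sum]
  have h2 := Measure.integral_comp_smul (volume : Measure Plane)
      (fun ξ : Plane => Complex.exp (Complex.I * (inner ℝ ξ x : ℝ)) *
        (ρ.low ((2 : ℝ) ^ (-(j : ℤ)) • ξ) : ℂ)) ((2 : ℝ) ^ j)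
  have e : ∀ ξ : Plane, (2 : ℝ) ^ (-(j : ℤ)) • (2 : ℝ) ^ j • ξ = ξ := fun ξ => by
    rw [smul_smul, zpow_neg, zpow_natCast, inv_mul_cancel₀ (by positivity), one_smul]
  simp only [e, inner_smul_left] at h2
  rw [finrank_euclideanSpace_fin, abs_of_pos (by positivity)] at h2
  have h3 := ρ.blockKernel_apply (-1) ((2 : ℝ) ^ j • x)
  simp only [inner_smul_right, symbol, if_true] at h3
  simp only [RCLike.conj_to_real] at h2
  rw [h2, smul_comm] at h3
  apply Complex.ofReal_injective
  rw [Complex.ofReal_mul, h3, h1, ← Complex.real_smul, smul_smul]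
  have : (4 : ℝ) ^ j * ((2 ^ j) ^ 2)⁻¹ = 1 := by
    rw [← pow_mul, mul_comm j 2, pow_mul]; norm_num
  rw [this, one_smul]

theorem kernel_neg_one : ρ.kernel (-1) = 0 := by simp [kernel]

/-- The kernels of the low frequency projections are bounded in `L¹`. -/
theorem lintegral_kernel_le {j : ℤ} (hj : -1 ≤ j) :
    ∫⁻ x, ‖ρ.kernel j x‖ₑ ≤ ∫⁻ x, ‖ρ.blockKernel (-1) x‖ₑ := by
  rcases hj.lt_or_eq with h | rfl
  · obtain ⟨m, rfl⟩ := Int.eq_ofNat_of_zero_le (show 0 ≤ j by omega)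
    simp only [kernel_apply, enorm_mul]
    have hk : Measurable fun x => ‖ρ.blockKernel (-1) x‖ₑ :=
      (ρ.blockKernel (-1)).continuous.measurable.enorm
    have hm : Measurable fun x : Plane => (2 : ℝ) ^ m • x := by fun_prop
    rw [lintegral_const_mul _ (by exact hk.comp hm),
      ← lintegral_map (μ := volume) hk hm, Measure.map_addHaar_smul _ (by positivity),
      lintegral_smul_measure, finrank_euclideanSpace_fin, smul_eq_mul, ← mul_assoc,
      Real.enorm_eq_ofReal (by positivity), ← ENNReal.ofReal_mul (by positivity),
      abs_of_pos (by positivity)]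
    have : (4 : ℝ) ^ m * ((2 ^ m) ^ 2)⁻¹ = 1 := by
      rw [← pow_mul, mul_comm m 2, pow_mul]; norm_num
    rw [this, ENNReal.ofReal_one, one_mul]
  · simp [kernel_neg_one]

theorem lintegral_blockKernel_lt_top (i : ℤ) : ∫⁻ x, ‖ρ.blockKernel i x‖ₑ < ∞ :=
  (ρ.blockKernel i).integrable.2

end DyadicGenerator

/-! ### The speed measure of a function and its image -/

/-- The measure `|y'(t)| dt`. -/
noncomputable def speedMeasure (y : ℝ → ℝ) : Measure ℝ :=
  volume.withDensity fun t => (‖deriv y t‖₊ : ℝ≥0∞)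

/-- The image under `y` of the measure `|y'(t)| dt`. -/
noncomputable def occupation (y : ℝ → ℝ) : Measure ℝ := (speedMeasure y).map y

theorem measurable_nnnorm_deriv (y : ℝ → ℝ) : Measurable fun t => ‖deriv y t‖₊ :=
  (measurable_deriv y).nnnorm

/-- Near a point with `y' ≠ 0` the function is injective by the inverse function theorem. The change
of variables formula then makes the integral of `|y'|` over a small piece equal to the length of its
image, which lies in the null set `B`; so the piece is null, and being null is a local property. -/
theorem volume_preimage_inter_deriv_ne_zero {y : ℝ → ℝ} (hy : ContDiff ℝ 1 y) {B : Set ℝ}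
    (hB : MeasurableSet B) (hB0 : volume B = 0) :
    volume {t | y t ∈ B ∧ deriv y t ≠ 0} = 0 := by
  have hSm : MeasurableSet {t | y t ∈ B ∧ deriv y t ≠ 0} :=
    (hy.continuous.measurable hB).inter
      ((measurable_deriv y) (measurableSet_singleton (0 : ℝ)).compl)
  refine measure_null_of_locally_null _ fun x hx => ?_
  have hs := (hy.hasStrictDerivAt (x := x) one_ne_zero).hasStrictFDerivAt_equiv hx.2
  let e := hs.toOpenPartialHomeomorph y
  have he : Set.InjOn y e.source := by
    have := e.injOn
    rwa [HasStrictFDerivAt.toOpenPartialHomeomorph_coe] at this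
  refine ⟨e.source ∩ {t | y t ∈ B ∧ deriv y t ≠ 0}, ?_, ?_⟩
  · exact Filter.inter_mem (mem_nhdsWithin_of_mem_nhds
      (e.open_source.mem_nhds hs.mem_toOpenPartialHomeomorph_source)) self_mem_nhdsWithin
  set u := e.source ∩ {t | y t ∈ B ∧ deriv y t ≠ 0} with hu
  have hum : MeasurableSet u := e.open_source.measurableSet.inter hSm
  have h1 := lintegral_image_eq_lintegral_abs_deriv_mul (s := u) (f := y) (f' := deriv y) hum
    (fun x _ => ((hy.differentiable one_ne_zero) x).hasDerivAt.hasDerivWithinAt)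
    (he.mono Set.inter_subset_left) (fun _ => 1)
  have h2 : volume (y '' u) = 0 := by
    refine measure_mono_null ?_ hB0
    rintro _ ⟨t, ht, rfl⟩
    exact ht.2.1
  simp only [mul_one, lintegral_one, Measure.restrict_apply_univ, h2] at h1
  have h3 := (setLIntegral_eq_zero_iff hum (by
    exact (measurable_deriv y).norm.ennreal_ofReal)).1 h1.symm
  rw [measure_eq_zero_iff_ae_notMem]
  filter_upwards [h3] with t ht htu
  have := ht htu
  rw [ENNReal.ofReal_eq_zero] at this
  exact htu.2.2 (abs_nonpos_iff.1 this)

/-- Critical points carry no speed, so only the regular part of the preimage counts. -/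
theorem occupation_absolutelyContinuous {y : ℝ → ℝ} (hy : ContDiff ℝ 1 y) :
    occupation y ≪ volume := by
  refine Measure.AbsolutelyContinuous.mk fun B hB hB0 => ?_
  rw [occupation, Measure.map_apply hy.continuous.measurable hB, speedMeasure,
    withDensity_apply _ (hy.continuous.measurable hB),
    setLIntegral_eq_zero_iff (hy.continuous.measurable hB)
      (measurable_nnnorm_deriv y).coe_nnreal_ennreal]
  have := volume_preimage_inter_deriv_ne_zero hy hB hB0
  rw [measure_eq_zero_iff_ae_notMem] at this
  filter_upwards [this] with t ht htB
  by_contra hne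
  exact ht ⟨htB, by simpa using hne⟩

/-! ### Cartesian coordinates on the plane -/

/-- The point with given Cartesian coordinates. -/
noncomputable def planeMk (p : ℝ × ℝ) : Plane := !₂[p.1, p.2]

theorem continuous_planeMk : Continuous planeMk := by
  unfold planeMk
  refine (PiLp.continuous_toLp 2 (fun _ : Fin 2 => ℝ)).comp (continuous_pi fun i => ?_)
  fin_cases i
  · exact continuous_fst
  · exact continuous_snd

theorem measurePreserving_planeMk : MeasurePreserving planeMk := by
  have h1 : MeasurePreserving (WithLp.toLp 2 : (Fin 2 → ℝ) → Plane) :=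
    PiLp.volume_preserving_toLp (Fin 2)
  have h2 := (volume_preserving_finTwoArrow ℝ).symm
  have h := h1.comp h2
  exact h

/-! ### Curves -/

namespace IsCurve

theorem contDiff_coord {c : ℝ → Plane} (hc : IsCurve c) (i : Fin 2) :
    ContDiff ℝ (⊤ : ℕ∞) fun u => c u i :=
  (contDiff_piLp_apply (p := 2) (i := i)).comp hc.smooth

theorem continuous_deriv_coord {c : ℝ → Plane} (hc : IsCurve c) (i : Fin 2) :
    Continuous (deriv fun u => c u i) :=
  (hc.contDiff_coord i).continuous_deriv (by exact_mod_cast le_top)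

theorem continuous_coord {c : ℝ → Plane} (hc : IsCurve c) (i : Fin 2) :
    Continuous fun u => c u i :=
  (hc.contDiff_coord i).continuous

theorem deriv_coord_eq_zero {c : ℝ → Plane} (hc : IsCurve c) (i : Fin 2)
    {t : ℝ} (ht : t ∉ Set.Icc (0 : ℝ) 1) :
    deriv (fun u => c u i) t = 0 := by
  have h1 : deriv c t = 0 := by
    by_contra h
    exact ht (hc.supp (subset_tsupport _ h))
  have hd : HasDerivAt c (deriv c t) t :=
    ((hc.smooth.differentiable (by simp)) t).hasDerivAt
  have := (EuclideanSpace.proj i : Plane →L[ℝ] ℝ).hasFDerivAt.comp_hasDerivAt t hd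
  rw [h1] at this
  simpa [Function.comp_def] using this.deriv

theorem exists_lower_bound {c : ℝ → Plane} (hc : IsCurve c) :
    ∃ δ : ℝ, 0 < δ ∧ ∀ t ∈ Set.Icc (0 : ℝ) 1, δ ≤ c t 0 := by
  obtain ⟨t₀, _, h⟩ := isCompact_Icc.exists_isMinOn (Set.nonempty_Icc.2 zero_le_one)
    (hc.continuous_coord 0).continuousOn
  exact ⟨c t₀ 0, hc.pos t₀, fun t ht => h ht⟩

theorem exists_upper_bound {c : ℝ → Plane} (hc : IsCurve c) (i : Fin 2) :
    ∃ R : ℝ, 0 < R ∧ ∀ t ∈ Set.Icc (0 : ℝ) 1, |c t i| ≤ R := by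
  obtain ⟨R, h⟩ := isCompact_Icc.exists_bound_of_continuousOn (s := Set.Icc (0 : ℝ) 1)
    (hc.continuous_coord i).continuousOn
  exact ⟨max R 1, by positivity, fun t ht => (h t ht).trans (le_max_left _ _)⟩

theorem exists_speed_bound {c : ℝ → Plane} (hc : IsCurve c) :
    ∃ S : ℝ, 0 < S ∧ ∀ t, |deriv (fun u => c u 1) t| ≤ S := by
  obtain ⟨R, h⟩ := isCompact_Icc.exists_bound_of_continuousOn (s := Set.Icc (0 : ℝ) 1)
    (hc.continuous_deriv_coord 1).continuousOn
  refine ⟨max R 1, by positivity, fun t => ?_⟩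
  by_cases ht : t ∈ Set.Icc (0 : ℝ) 1
  · exact (h t ht).trans (le_max_left _ _)
  · rw [hc.deriv_coord_eq_zero 1 ht]; simp

theorem hasCompactSupport_deriv_coord {c : ℝ → Plane} (hc : IsCurve c) (i : Fin 2) :
    HasCompactSupport (deriv fun u => c u i) :=
  HasCompactSupport.intro isCompact_Icc fun _ ht => hc.deriv_coord_eq_zero i ht

theorem isFiniteMeasure_speedMeasure {c : ℝ → Plane} (hc : IsCurve c) :
    IsFiniteMeasure (speedMeasure fun u => c u 1) := by
  refine isFiniteMeasure_withDensity (ne_of_lt ?_)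
  exact ((hc.continuous_deriv_coord 1).integrable_of_hasCompactSupport
    (hc.hasCompactSupport_deriv_coord 1)).2

theorem isFiniteMeasure_occupation {c : ℝ → Plane} (hc : IsCurve c) :
    IsFiniteMeasure (occupation fun u => c u 1) :=
  have := hc.isFiniteMeasure_speedMeasure
  inferInstanceAs (IsFiniteMeasure (Measure.map _ _))

end IsCurve

/-! ### Bounded density of the occupation measure -/

/-- The set of levels at which the density of the occupation measure of `c₂` is at most `k`. -/
noncomputable def lowLevels (c : ℝ → Plane) (k : ℕ) : Set ℝ :=
  {z | (occupation fun u => c u 1).rnDeriv volume z ≤ k}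

theorem measurableSet_lowLevels (c : ℝ → Plane) (k : ℕ) : MeasurableSet (lowLevels c k) :=
  measurableSet_le (Measure.measurable_rnDeriv _ _) measurable_const

/-- The function `sign(c₂') 1_{c₂ ∈ lowLevels}`. -/
noncomputable def lowSign (c : ℝ → Plane) (k : ℕ) (t : ℝ) : ℝ :=
  (SignType.sign (deriv (fun u => c u 1) t) : ℝ) * (lowLevels c k).indicator 1 (c t 1)

/-- The sign turns the weight `c₂'` of the pairing into `|c₂'|`, so upward and downward passages
through a level add up instead of cancelling. -/
theorem lowSign_mul_deriv (c : ℝ → Plane) (k : ℕ) (t : ℝ) :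
    lowSign c k t * deriv (fun u => c u 1) t =
      (lowLevels c k).indicator 1 (c t 1) * |deriv (fun u => c u 1) t| := by
  rw [lowSign, mul_right_comm, sign_mul_self, mul_comm]

theorem abs_lowSign_le (c : ℝ → Plane) (k : ℕ) (t : ℝ) : |lowSign c k t| ≤ 1 := by
  unfold lowSign
  rw [abs_mul]
  have h1 : |(SignType.sign (deriv (fun u => c u 1) t) : ℝ)| ≤ 1 := by
    rcases lt_trichotomy (deriv (fun u => c u 1) t) 0 with h | h | h <;> simp [h]
  have h2 : |(lowLevels c k).indicator (1 : ℝ → ℝ) (c t 1)| ≤ 1 := by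
    by_cases h : c t 1 ∈ lowLevels c k <;> simp [h]
  nlinarith [abs_nonneg ((lowLevels c k).indicator (1 : ℝ → ℝ) (c t 1)),
    abs_nonneg ((SignType.sign (deriv (fun u => c u 1) t) : ℝ))]

theorem IsCurve.measurable_lowSign {c : ℝ → Plane} (hc : IsCurve c) (k : ℕ) :
    Measurable (lowSign c k) := by
  have h1 : Measurable fun x : ℝ => (SignType.sign x : ℝ) := by
    have : (fun x : ℝ => (SignType.sign x : ℝ)) =
        fun x => if 0 < x then 1 else if x < 0 then -1 else 0 := by
      ext x
      rcases lt_trichotomy x 0 with h | h | h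
      · simp [h, h.not_gt]
      · simp [h]
      · simp [h]
    rw [this]
    exact Measurable.ite measurableSet_Ioi measurable_const
      (Measurable.ite measurableSet_Iio measurable_const measurable_const)
  exact (h1.comp (measurable_deriv _)).mul
    (((measurable_one).indicator (measurableSet_lowLevels c k)).comp
      (hc.continuous_coord 1).measurable)

theorem IsCurve.occupation_inter_lowLevels_le {c : ℝ → Plane} (hc : IsCurve c) (k : ℕ) {S : Set ℝ}
    (hS : MeasurableSet S) :
    occupation (fun u => c u 1) (S ∩ lowLevels c k) ≤ k * volume S := by
  have := hc.isFiniteMeasure_occupation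
  have hac : occupation (fun u => c u 1) ≪ volume :=
    occupation_absolutelyContinuous ((hc.contDiff_coord 1).of_le (by exact_mod_cast le_top))
  have hm := hS.inter (measurableSet_lowLevels c k)
  rw [← Measure.setLIntegral_rnDeriv hac]
  calc ∫⁻ x in S ∩ lowLevels c k, (occupation fun u => c u 1).rnDeriv volume x
      ≤ ∫⁻ x in S ∩ lowLevels c k, (k : ℝ≥0∞) :=
        setLIntegral_mono measurable_const fun x hx => hx.2
    _ = k * volume (S ∩ lowLevels c k) := by simp
    _ ≤ k * volume S := by gcongr; exact Set.inter_subset_left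

/-- The parameters `(t, x)` of the points `(x, c₂(t))`, `x ≤ c₁(t)`, at low levels. -/
def lowRegion (c : ℝ → Plane) (k : ℕ) : Set (ℝ × ℝ) :=
  {q | q.2 ≤ c q.1 0 ∧ c q.1 1 ∈ lowLevels c k}

/-- The map `(t, x) ↦ (x, c₂(t))`. -/
noncomputable def sweep (c : ℝ → Plane) (q : ℝ × ℝ) : Plane := planeMk (q.2, c q.1 1)

/-- The measure with density `ℰ_c h` for `h = lowSign c k`. -/
noncomputable def sweepMeasure (c : ℝ → Plane) (k : ℕ) (R : ℝ) : Measure Plane :=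
  ((((speedMeasure fun u => c u 1).prod (volume.restrict (Set.Ioc 0 R))).restrict
    (lowRegion c k)).map (sweep c))

theorem IsCurve.measurableSet_lowRegion {c : ℝ → Plane} (hc : IsCurve c) (k : ℕ) :
    MeasurableSet (lowRegion c k) := by
  refine (measurableSet_le measurable_snd ?_).inter ?_
  · exact (hc.continuous_coord 0).measurable.comp measurable_fst
  · exact ((hc.continuous_coord 1).measurable.comp measurable_fst) (measurableSet_lowLevels c k)

theorem IsCurve.continuous_sweep {c : ℝ → Plane} (hc : IsCurve c) : Continuous (sweep c) :=
  continuous_planeMk.comp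
    (continuous_snd.prodMk ((hc.continuous_coord 1).comp continuous_fst))

theorem IsCurve.isFiniteMeasure_sweepMeasure {c : ℝ → Plane} (hc : IsCurve c) (k : ℕ) (R : ℝ) :
    IsFiniteMeasure (sweepMeasure c k R) := by
  have := hc.isFiniteMeasure_speedMeasure
  unfold sweepMeasure
  infer_instance

/-- Slice at fixed `x`: forgetting the constraint `x ≤ c₁(t)`, the section in `t` has at most the
occupation mass of a section of `A` at low levels, where the density is at most `k`. Tonelli
concludes. -/
theorem IsCurve.sweepMeasure_le {c : ℝ → Plane} (hc : IsCurve c) (k : ℕ) (R : ℝ) :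
    sweepMeasure c k R ≤ (k : ℝ≥0∞) • volume := by
  have := hc.isFiniteMeasure_speedMeasure
  refine Measure.le_iff.2 fun A hA => ?_
  have hsw := hc.continuous_sweep.measurable
  have hpm := continuous_planeMk.measurable
  rw [sweepMeasure, Measure.map_apply hsw hA,
    Measure.restrict_apply (hsw hA),
    Measure.prod_apply_symm ((hsw hA).inter (hc.measurableSet_lowRegion k)),
    Measure.smul_apply, smul_eq_mul, ← measurePreserving_planeMk.measure_preimage hA.nullMeasurableSet,
    Measure.volume_eq_prod, Measure.prod_apply (hpm hA),
    ← lintegral_const_mul _ (measurable_measure_prodMk_left (hpm hA))]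
  refine (lintegral_mono fun x => ?_).trans (setLIntegral_le_lintegral _ _)
  have hB : MeasurableSet (Prod.mk x ⁻¹' (planeMk ⁻¹' A)) := measurable_prodMk_left (hpm hA)
  refine le_trans ?_ (hc.occupation_inter_lowLevels_le k hB)
  rw [occupation, Measure.map_apply (hc.continuous_coord 1).measurable
    (hB.inter (measurableSet_lowLevels c k))]
  refine measure_mono fun t ht => ⟨ht.1, ht.2.2⟩

/-- The cutoff `R` only serves to keep the product measure finite: it exceeds `c₁` on `[0, 1]`, and
`c₂'` vanishes outside. -/
theorem IsCurve.integral_sweepMeasure {c : ℝ → Plane} (hc : IsCurve c) (k : ℕ) {R : ℝ}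
    (hR : ∀ t ∈ Set.Icc (0 : ℝ) 1, |c t 0| ≤ R) {H : Plane → ℝ} (hH : MemLp H 2 volume) :
    ∫ x, H x ∂(sweepMeasure c k R) = curvePairing c H (lowSign c k) := by
  have := hc.isFiniteMeasure_speedMeasure
  have := hc.isFiniteMeasure_sweepMeasure k R
  have hHi : Integrable H (sweepMeasure c k R) :=
    (hH.of_measure_le_smul (ENNReal.natCast_ne_top k) (hc.sweepMeasure_le k R)).integrable
      (by norm_num)
  have hsw := hc.continuous_sweep.measurable
  have hi1 : Integrable (fun q => (lowRegion c k).indicator (fun q => H (sweep c q)) q)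
      ((speedMeasure fun u => c u 1).prod (volume.restrict (Set.Ioc 0 R))) := by
    rw [integrable_indicator_iff (hc.measurableSet_lowRegion k)]
    exact hHi.comp_measurable hsw
  rw [sweepMeasure, integral_map hsw.aemeasurable hHi.aestronglyMeasurable,
    ← integral_indicator (hc.measurableSet_lowRegion k), integral_prod _ hi1, speedMeasure,
    integral_withDensity_eq_integral_smul (measurable_nnnorm_deriv _), curvePairing]
  refine integral_congr_ae (Eventually.of_forall fun t => ?_)
  by_cases ht : t ∈ Set.Icc (0 : ℝ) 1
  swap
  · simp [hc.deriv_coord_eq_zero 1 ht]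
  have h1 : c t 0 ≤ R := (le_abs_self _).trans (hR t ht)
  have h0 := (hc.pos t).le
  simp only [mul_assoc, lowSign_mul_deriv]
  rw [intervalIntegral.integral_mul_const, intervalIntegral.integral_of_le h0, NNReal.smul_def,
    coe_nnnorm, Real.norm_eq_abs, smul_eq_mul, mul_comm, ← mul_assoc]
  congr 1
  by_cases hl : c t 1 ∈ lowLevels c k
  · rw [Set.indicator_of_mem hl, Pi.one_apply, mul_one,
      ← integral_indicator measurableSet_Ioc, ← integral_indicator measurableSet_Ioc]
    congr 1
    ext x
    by_cases hx : x ∈ Set.Ioc 0 (c t 0)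
    · have hx' : x ∈ Set.Ioc 0 R := ⟨hx.1, hx.2.trans h1⟩
      have hm : (t, x) ∈ lowRegion c k := ⟨hx.2, hl⟩
      rw [Set.indicator_of_mem hx, Set.indicator_of_mem hx', Set.indicator_of_mem hm]
      rfl
    · rw [Set.indicator_of_notMem hx, Set.indicator_apply_eq_zero]
      intro hx'
      rw [Set.indicator_of_notMem]
      exact fun hm => hx ⟨hx'.1, hm.1⟩
  · rw [Set.indicator_of_notMem hl, mul_zero]
    refine (integral_congr_ae (g := fun _ => 0) (Eventually.of_forall fun x => ?_)).trans (by simp)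
    exact Set.indicator_of_notMem (fun hm => hl hm.2) _

/-- `curveOp` takes the default value 0 when no representative exists, so the hypothesis on
`curveOpNorm` says something only for functions `h` that have one. Truncating to low levels
guarantees this: the swept measure is finite with density at most `k`, so the density lies in `L²`.
-/
theorem IsCurve.exists_representsCurve_lowSign {c : ℝ → Plane} (hc : IsCurve c) (k : ℕ) :
    ∃ u, RepresentsCurve c (lowSign c k) u := by
  obtain ⟨R, _, hR⟩ := hc.exists_upper_bound 0
  have := hc.isFiniteMeasure_sweepMeasure k R
  set ν := sweepMeasure c k R with hν
  have hle := hc.sweepMeasure_le k R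
  have hac : ν ≪ volume := (Measure.absolutelyContinuous_of_le hle).trans
    (Measure.smul_absolutelyContinuous)
  have hb : ν.rnDeriv volume ≤ᵐ[volume] fun _ => (k : ℝ≥0∞) := by
    refine ae_le_of_forall_setLIntegral_le_of_sigmaFinite (Measure.measurable_rnDeriv _ _) ?_
    intro s hs _
    rw [Measure.setLIntegral_rnDeriv hac]
    simpa using hle s
  refine ⟨fun x => (ν.rnDeriv volume x).toReal, ?_, fun H hH => ?_⟩
  · have hi : Integrable (fun x => (ν.rnDeriv volume x).toReal) volume :=
      Measure.integrable_toReal_rnDeriv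
    rw [memLp_two_iff_integrable_sq hi.aestronglyMeasurable]
    refine (hi.const_mul (k : ℝ)).mono' (hi.aestronglyMeasurable.pow 2) ?_
    filter_upwards [hb] with x hx
    have h1 : (ν.rnDeriv volume x).toReal ≤ k := by
      have := ENNReal.toReal_mono (ENNReal.natCast_ne_top k) hx
      simpa using this
    rw [Real.norm_of_nonneg (by positivity), sq]
    exact mul_le_mul_of_nonneg_right h1 ENNReal.toReal_nonneg
  · rw [← hc.integral_sweepMeasure k hR hH, ← integral_rnDeriv_smul hac]
    simp [mul_comm]

/-- Test `ℰ_c h`, with `h = lowSign c k`, against the indicator of `(0, δ] × B`, where `δ` is a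
lower bound of `c₁`. The pairing equals `δ` times the occupation mass of `B` at low levels, and the
sup bound makes it at most `‖ℰ_c‖ δ |B|`. Cancel `δ`, let `k → ∞`, and recover the bound on the
density from sets `B` of finite length. -/
theorem IsCurve.exists_occupation_le {c : ℝ → Plane} (hc : IsCurve c) (hcE : curveOpNorm c < ∞) :
    ∃ M : ℝ≥0, occupation (fun u => c u 1) ≤ (M : ℝ≥0∞) • volume := by
  have := hc.isFiniteMeasure_occupation
  have hac : occupation (fun u => c u 1) ≪ volume :=
    occupation_absolutelyContinuous ((hc.contDiff_coord 1).of_le (by exact_mod_cast le_top))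
  obtain ⟨δ, hδ, hδc⟩ := hc.exists_lower_bound
  have key : ∀ (k : ℕ) (B : Set ℝ), MeasurableSet B → volume B < ∞ →
      occupation (fun u => c u 1) (B ∩ lowLevels c k) ≤ curveOpNorm c * volume B := by
    intro k B hB hBf
    have hrep : RepresentsCurve c (lowSign c k) (curveOp c (lowSign c k)) := by
      have hex := hc.exists_representsCurve_lowSign k
      rw [curveOp, dif_pos hex]
      exact hex.choose_spec
    have hu : eLpNorm (curveOp c (lowSign c k)) ∞ volume ≤ curveOpNorm c := by
      refine le_iSup_of_le (lowSign c k) (le_iSup_of_le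
        (hc.measurable_lowSign k).aestronglyMeasurable (le_iSup_of_le ?_ le_rfl))
      have := eLpNormEssSup_le_of_ae_bound (f := lowSign c k) (μ := (volume : Measure ℝ)) (C := 1)
        (Eventually.of_forall fun t => abs_lowSign_le c k t)
      simpa using this
    have hub : ∀ᵐ x, ‖curveOp c (lowSign c k) x‖ ≤ (curveOpNorm c).toReal := by
      filter_upwards [ae_le_eLpNormEssSup (f := curveOp c (lowSign c k))
        (μ := (volume : Measure Plane))] with x hx
      rw [eLpNorm_exponent_top] at hu
      have := ENNReal.toReal_mono hcE.ne (hx.trans hu)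
      simpa using this
    -- As `δ ≤ c₁(t)` on `[0, 1]`, each segment from `0` to `c₁(t)` crosses the full width of the
    -- strip.
    set A : Set Plane := {x | x 0 ∈ Set.Ioc 0 δ ∧ x 1 ∈ B} with hA
    have hAm : MeasurableSet A :=
      ((by fun_prop : Measurable fun x : Plane => x 0) measurableSet_Ioc).inter
        ((by fun_prop : Measurable fun x : Plane => x 1) hB)
    have hAv : volume A = ENNReal.ofReal δ * volume B := by
      rw [← measurePreserving_planeMk.measure_preimage hAm.nullMeasurableSet]
      have : planeMk ⁻¹' A = Set.Ioc 0 δ ×ˢ B := by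
        ext p; simp [A, planeMk]
      rw [this, Measure.volume_eq_prod, Measure.prod_prod, Real.volume_Ioc, sub_zero]
    have hAf : volume A ≠ ∞ := hAv ▸ ENNReal.mul_ne_top ENNReal.ofReal_ne_top hBf.ne
    have hpair := hrep.2 (A.indicator 1) (memLp_indicator_const 2 hAm (1 : ℝ) (Or.inr hAf))
    have hlhs : ∫ x, A.indicator 1 x * curveOp c (lowSign c k) x ≤
        (curveOpNorm c).toReal * (volume A).toReal := by
      have e : ∀ x, A.indicator (1 : Plane → ℝ) x * curveOp c (lowSign c k) x =
          A.indicator (curveOp c (lowSign c k)) x := fun x => by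
        by_cases hx : x ∈ A <;> simp [hx]
      simp only [e]
      rw [integral_indicator hAm]
      exact (le_abs_self _).trans (norm_setIntegral_le_of_norm_le_const_ae hAf.lt_top
        (ae_restrict_of_ae hub))
    have hm := hB.inter (measurableSet_lowLevels c k)
    have hrhs : curvePairing c (A.indicator 1) (lowSign c k) =
        δ * (occupation (fun u => c u 1) (B ∩ lowLevels c k)).toReal := by
      have e1 : (occupation (fun u => c u 1) (B ∩ lowLevels c k)).toReal =
          ∫ t, |deriv (fun u => c u 1) t| * (B ∩ lowLevels c k).indicator 1 (c t 1) := by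
        have : (occupation (fun u => c u 1) (B ∩ lowLevels c k)).toReal =
            ∫ z, (B ∩ lowLevels c k).indicator (1 : ℝ → ℝ) z ∂(occupation fun u => c u 1) := by
          rw [integral_indicator_one hm]; rfl
        rw [this, occupation, integral_map (hc.continuous_coord 1).measurable.aemeasurable
          ((measurable_one.indicator hm).aestronglyMeasurable), speedMeasure,
          integral_withDensity_eq_integral_smul (measurable_nnnorm_deriv _)]
        rfl
      rw [e1, ← integral_const_mul, curvePairing]
      refine integral_congr_ae (Eventually.of_forall fun t => ?_)
      by_cases ht : t ∈ Set.Icc (0 : ℝ) 1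
      swap
      · simp [hc.deriv_coord_eq_zero 1 ht]
      simp only [mul_assoc, lowSign_mul_deriv]
      rw [intervalIntegral.integral_mul_const, intervalIntegral.integral_of_le (hc.pos t).le]
      have e2 : ∫ x in Set.Ioc 0 (c t 0), A.indicator (1 : Plane → ℝ) !₂[x, c t 1] =
          δ * B.indicator 1 (c t 1) := by
        have e3 : ∀ x, A.indicator (1 : Plane → ℝ) !₂[x, c t 1] =
            (Set.Ioc 0 δ).indicator (fun _ => B.indicator (1 : ℝ → ℝ) (c t 1)) x := by
          intro x
          by_cases hx : x ∈ Set.Ioc 0 δ <;> by_cases hb : c t 1 ∈ B <;>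
            simp_all [A, Set.indicator]
        simp only [e3]
        rw [integral_indicator measurableSet_Ioc, Measure.restrict_restrict measurableSet_Ioc,
          Set.inter_eq_left.2 (Set.Ioc_subset_Ioc_right (hδc t ht))]
        simp [hδ.le]
      rw [e2]
      by_cases hb : c t 1 ∈ B <;> by_cases hl : c t 1 ∈ lowLevels c k <;> simp [hb, hl]
    rw [hpair, hrhs, hAv, ENNReal.toReal_mul, ENNReal.toReal_ofReal hδ.le] at hlhs
    have hfin : (occupation (fun u => c u 1) (B ∩ lowLevels c k)).toReal ≤
        (curveOpNorm c).toReal * (volume B).toReal := by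
      refine le_of_mul_le_mul_left ?_ hδ
      linarith
    rw [← ENNReal.toReal_mul] at hfin
    exact (ENNReal.toReal_le_toReal (measure_ne_top _ _) (ENNReal.mul_ne_top hcE.ne hBf.ne)).1 hfin
  refine ⟨(curveOpNorm c).toNNReal, ?_⟩
  rw [ENNReal.coe_toNNReal hcE.ne]
  have hmono : Monotone (lowLevels c) := fun k l hkl z hz =>
    le_trans (b := (k : ℝ≥0∞)) hz (by exact_mod_cast hkl)
  -- The occupation measure is finite, so its density is finite almost everywhere and the low levels
  -- exhaust it.
  have hall : ∀ᵐ z ∂(occupation fun u => c u 1), z ∈ ⋃ k, lowLevels c k := by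
    filter_upwards [hac.ae_le (Measure.rnDeriv_lt_top (occupation fun u => c u 1) volume)]
      with z hz
    obtain ⟨k, hk⟩ := ENNReal.exists_nat_gt hz.ne
    exact Set.mem_iUnion.2 ⟨k, hk.le⟩
  have hB : ∀ B : Set ℝ, MeasurableSet B → volume B < ∞ →
      occupation (fun u => c u 1) B ≤ curveOpNorm c * volume B := by
    intro B hB hBf
    have h1 : occupation (fun u => c u 1) B =
        occupation (fun u => c u 1) (⋃ k, B ∩ lowLevels c k) := by
      refine measure_congr ?_
      filter_upwards [hall] with z hz
      rw [← Set.inter_iUnion]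
      exact propext ⟨fun h => ⟨h, hz⟩, fun h => h.1⟩
    rw [h1, (show Monotone fun k => B ∩ lowLevels c k from
      fun k l hkl => Set.inter_subset_inter_right _ (hmono hkl)).measure_iUnion]
    exact iSup_le fun k => key k B hB hBf
  have hae : (occupation fun u => c u 1).rnDeriv volume ≤ᵐ[volume] fun _ => curveOpNorm c := by
    refine ae_le_of_forall_setLIntegral_le_of_sigmaFinite (Measure.measurable_rnDeriv _ _) ?_
    intro B hBm hBf
    rw [Measure.setLIntegral_rnDeriv hac]
    simpa using hB B hBm hBf
  rw [← Measure.withDensity_rnDeriv_eq _ _ hac]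
  refine (withDensity_mono hae).trans ?_
  rw [withDensity_const]

/-! ### Convolution with an integrable kernel on `L²` -/

/-- Cauchy–Schwarz after splitting `k = √k · √k`. -/
theorem sq_lintegral_mul_le {α : Type*} [MeasurableSpace α] {μ : Measure α} {k f : α → ℝ≥0∞}
    (hk : AEMeasurable k μ) (hf : AEMeasurable f μ) :
    (∫⁻ x, k x * f x ∂μ) ^ 2 ≤ (∫⁻ x, k x ∂μ) * ∫⁻ x, k x * f x ^ 2 ∂μ := by
  have h := ENNReal.lintegral_mul_le_Lp_mul_Lq μ Real.HolderConjugate.two_two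
    (f := fun x => k x ^ (1 / 2 : ℝ)) (g := fun x => k x ^ (1 / 2 : ℝ) * f x)
    (hk.pow_const _) ((hk.pow_const _).mul hf)
  have e0 : ∀ x, k x ^ (1 / 2 : ℝ) * k x ^ (1 / 2 : ℝ) = k x := fun x => by
    rw [← ENNReal.rpow_add_of_nonneg _ _ (by norm_num) (by norm_num)]; norm_num
  have e1 : ∀ x, (k x ^ (1 / 2 : ℝ)) ^ (2 : ℝ) = k x := fun x => by
    rw [← ENNReal.rpow_mul]; norm_num
  simp only [Pi.mul_apply, ← mul_assoc, e0, ENNReal.mul_rpow_of_nonneg _ _ (zero_le_two (α := ℝ)),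
    e1, ENNReal.rpow_two] at h
  have h2 := pow_le_pow_left₀ (zero_le) h 2
  rw [mul_pow] at h2
  have e2 : ∀ z : ℝ≥0∞, (z ^ (1 / 2 : ℝ)) ^ 2 = z := fun z => by
    rw [← ENNReal.rpow_two, ← ENNReal.rpow_mul]; norm_num
  rwa [e2, e2] at h2

/-- The curve `x ↦ K(x - ·)` in `L²`. -/
noncomputable def shiftLp (K : 𝓢(Plane, ℝ)) (x : Plane) : Lp ℝ 2 (volume : Measure Plane) :=
  (reflectShift K x).toLp 2 volume

theorem continuous_shiftLp (K : 𝓢(Plane, ℝ)) : Continuous (shiftLp K) :=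
  (SchwartzMap.toLpCLM ℝ ℝ 2 (volume : Measure Plane)).continuous.comp (continuous_reflectShift K)

theorem lintegral_sq_enorm_eq {α E : Type*} [MeasurableSpace α] {μ : Measure α}
    [NormedAddCommGroup E] (F : Lp E 2 μ) : ∫⁻ x, ‖F x‖ₑ ^ 2 ∂μ = ‖F‖ₑ ^ 2 := by
  rw [Lp.enorm_def, eLpNorm_eq_lintegral_rpow_enorm_toReal (by norm_num) (by norm_num)]
  simp only [ENNReal.toReal_ofNat, ENNReal.rpow_two]
  rw [← ENNReal.rpow_two, ← ENNReal.rpow_mul]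
  norm_num

/-- The inner product is the convolution `K * F` at `x`, so this is Young's inequality `L¹ * L² →
L²`: Cauchy–Schwarz for the weight `|K(x - y)|`, then Tonelli. -/
theorem lintegral_sq_inner_shiftLp_le (K : 𝓢(Plane, ℝ)) (F : Lp ℝ 2 (volume : Measure Plane)) :
    ∫⁻ x, ‖(inner ℝ F (shiftLp K x) : ℝ)‖ₑ ^ 2 ≤ (∫⁻ x, ‖K x‖ₑ) ^ 2 * ‖F‖ₑ ^ 2 := by
  have hK : Measurable fun x => ‖K x‖ₑ := K.continuous.measurable.enorm
  have hF : Measurable fun y => ‖F y‖ₑ := (Lp.stronglyMeasurable F).measurable.enorm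
  have h1 : ∀ x, ‖(inner ℝ F (shiftLp K x) : ℝ)‖ₑ ^ 2 ≤
      (∫⁻ y, ‖K y‖ₑ) * ∫⁻ y, ‖K (x - y)‖ₑ * ‖F y‖ₑ ^ 2 := by
    intro x
    have hKx : Measurable fun y => ‖K (x - y)‖ₑ := hK.comp (measurable_const.sub measurable_id)
    have e1 : (inner ℝ F (shiftLp K x) : ℝ) = ∫ y, K (x - y) * F y := by
      rw [L2.inner_def]
      refine integral_congr_ae ?_
      filter_upwards [(reflectShift K x).coeFn_toLp 2 volume] with y hy
      rw [shiftLp, hy, reflectShift_apply]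
      rfl
    rw [e1]
    have h2 : ‖∫ y, K (x - y) * F y‖ₑ ≤ ∫⁻ y, ‖K (x - y)‖ₑ * ‖F y‖ₑ := by
      refine (enorm_integral_le_lintegral_enorm _).trans_eq ?_
      simp only [enorm_mul]
    have h3 := sq_lintegral_mul_le (μ := (volume : Measure Plane)) hKx.aemeasurable hF.aemeasurable
    rw [lintegral_sub_left_eq_self (fun y => ‖K y‖ₑ) x] at h3
    exact (pow_le_pow_left₀ zero_le h2 2).trans h3
  have hm : Measurable fun q : Plane × Plane => ‖K (q.1 - q.2)‖ₑ * ‖F q.2‖ₑ ^ 2 :=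
    (hK.comp (measurable_fst.sub measurable_snd)).mul ((hF.comp measurable_snd).pow_const 2)
  calc ∫⁻ x, ‖(inner ℝ F (shiftLp K x) : ℝ)‖ₑ ^ 2
      ≤ ∫⁻ x, (∫⁻ y, ‖K y‖ₑ) * ∫⁻ y, ‖K (x - y)‖ₑ * ‖F y‖ₑ ^ 2 := lintegral_mono h1
    _ = (∫⁻ y, ‖K y‖ₑ) * ∫⁻ x, ∫⁻ y, ‖K (x - y)‖ₑ * ‖F y‖ₑ ^ 2 :=
        lintegral_const_mul _ hm.lintegral_prod_right'
    _ = (∫⁻ y, ‖K y‖ₑ) * ∫⁻ y, ∫⁻ x, ‖K (x - y)‖ₑ * ‖F y‖ₑ ^ 2 := by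
        rw [lintegral_lintegral_swap hm.aemeasurable]
    _ = (∫⁻ y, ‖K y‖ₑ) * ((∫⁻ y, ‖K y‖ₑ) * ‖F‖ₑ ^ 2) := by
        congr 1
        rw [← lintegral_sq_enorm_eq, ← lintegral_const_mul _ (hF.pow_const 2)]
        refine lintegral_congr fun y => ?_
        rw [lintegral_mul_const _ (by exact hK.comp (measurable_id.sub measurable_const)),
          lintegral_sub_right_eq_self (fun x => ‖K x‖ₑ) y]
    _ = _ := by ring

/-! ### The energy estimate -/

/-- The velocity of the line integral along `c` of the axial gauge field with curvature `k`. -/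
noncomputable def velocity {E : Type*} [NormedAddCommGroup E] [NormedSpace ℝ E] (c : ℝ → Plane)
    (k : Plane → E) (r : ℝ) : E :=
  deriv (fun u => c u 1) r • ∫ ξ in (0 : ℝ)..(c r 0), k (planeMk (ξ, c r 1))

theorem IsCurve.continuous_axial {E : Type*} [NormedAddCommGroup E] [NormedSpace ℝ E]
    {c : ℝ → Plane} (hc : IsCurve c) {k : Plane → E} (hk : Continuous k) :
    Continuous fun r => ∫ ξ in (0 : ℝ)..(c r 0), k (planeMk (ξ, c r 1)) := by
  refine intervalIntegral.continuous_parametric_intervalIntegral_of_continuous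
    (f := fun r ξ => k (planeMk (ξ, c r 1))) ?_ (hc.continuous_coord 0)
  exact hk.comp (continuous_planeMk.comp
    (continuous_snd.prodMk ((hc.continuous_coord 1).comp continuous_fst)))

theorem IsCurve.continuous_velocity {E : Type*} [NormedAddCommGroup E] [NormedSpace ℝ E]
    {c : ℝ → Plane} (hc : IsCurve c) {k : Plane → E} (hk : Continuous k) :
    Continuous (velocity c k) :=
  (hc.continuous_deriv_coord 1).smul (hc.continuous_axial hk)

/-- Applied both to pairing with a fixed `L²` function, in the energy estimate, and to white noise
as a bounded operator. -/
theorem velocity_comp_clm {E F : Type*} [NormedAddCommGroup E] [NormedSpace ℝ E] [CompleteSpace E]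
    [NormedAddCommGroup F] [NormedSpace ℝ F] [CompleteSpace F] (c : ℝ → Plane) {k : Plane → E}
    (hk : Continuous k) (L : E →L[ℝ] F) (r : ℝ) :
    L (velocity c k r) = velocity c (fun x => L (k x)) r := by
  have : Continuous fun ξ => k (planeMk (ξ, c r 1)) :=
    hk.comp (continuous_planeMk.comp (continuous_id.prodMk continuous_const))
  rw [velocity, velocity, map_smul, ← L.intervalIntegral_comp_comm (this.intervalIntegrable _ _)]

/-- Substituting `z = c₂(t)` turns the left side into an integral against the occupation measure,
whose density is at most `M`. -/
theorem lintegral_speed_le {c : ℝ → Plane} (hc : IsCurve c) {M : ℝ≥0}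
    (hM : occupation (fun u => c u 1) ≤ (M : ℝ≥0∞) • volume) {g : ℝ → ℝ≥0∞} (hg : Measurable g) :
    ∫⁻ t, ‖deriv (fun u => c u 1) t‖ₑ * g (c t 1) ≤ M * ∫⁻ z, g z := by
  have h1 : ∫⁻ t, ‖deriv (fun u => c u 1) t‖ₑ * g (c t 1) =
      ∫⁻ z, g z ∂(occupation fun u => c u 1) := by
    rw [occupation, lintegral_map hg (hc.continuous_coord 1).measurable, speedMeasure,
      lintegral_withDensity_eq_lintegral_mul _ (measurable_nnnorm_deriv _).coe_nnreal_ennreal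
        (g := fun t => g (c t 1)) (hg.comp (hc.continuous_coord 1).measurable)]
    rfl
  rw [h1, ← smul_eq_mul, ← lintegral_smul_measure]
  exact lintegral_mono' hM le_rfl

/-- Extending the horizontal segments to full lines makes the inner integral a function of the
height alone. The bounded occupation density then compares the integral along the curve with the
integral over the plane. -/
theorem IsCurve.integral_speed_mul_le {c : ℝ → Plane} (hc : IsCurve c) {M : ℝ≥0}
    (hM : occupation (fun u => c u 1) ≤ (M : ℝ≥0∞) • volume) {G : Plane → ℝ} (hG : Continuous G)
    {Q : ℝ} (hQ0 : 0 ≤ Q) (hQ : ∫⁻ x, ‖G x‖ₑ ^ 2 ≤ ENNReal.ofReal Q) {R : ℝ} (hR : 0 ≤ R)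
    {s t : ℝ} (hst : s ≤ t) :
    ∫ r in s..t, |deriv (fun u => c u 1) r| * ∫ ξ in (0 : ℝ)..R, G (planeMk (ξ, c r 1)) ^ 2
      ≤ M * Q := by
  have hGm : Continuous fun q : ℝ × ℝ => G (planeMk q) := hG.comp continuous_planeMk
  have hmeas : Measurable fun q : ℝ × ℝ => ‖G (planeMk q)‖ₑ ^ 2 :=
    hGm.measurable.enorm.pow_const 2
  have hx : ∀ z, ENNReal.ofReal (∫ ξ in (0 : ℝ)..R, G (planeMk (ξ, z)) ^ 2) ≤
      ∫⁻ ξ, ‖G (planeMk (ξ, z))‖ₑ ^ 2 := by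
    intro z
    have hcz : Continuous fun ξ => G (planeMk (ξ, z)) ^ 2 :=
      (hGm.comp (continuous_id.prodMk continuous_const)).pow 2
    rw [intervalIntegral.integral_of_le hR, ofReal_integral_eq_lintegral_ofReal
      (hcz.integrableOn_Ioc) (Eventually.of_forall fun _ => sq_nonneg _)]
    refine (setLIntegral_le_lintegral _ _).trans (lintegral_mono fun ξ => ?_)
    rw [← sq_abs, ENNReal.ofReal_pow (abs_nonneg _), ← Real.norm_eq_abs, ofReal_norm]
  have hsw : ∫⁻ z, ∫⁻ ξ, ‖G (planeMk (ξ, z))‖ₑ ^ 2 = ∫⁻ x, ‖G x‖ₑ ^ 2 := by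
    rw [← measurePreserving_planeMk.lintegral_comp (hG.measurable.enorm.pow_const 2),
      Measure.volume_eq_prod, lintegral_prod_symm' _ hmeas]
  have hcont : Continuous fun r => |deriv (fun u => c u 1) r| *
      ∫ ξ in (0 : ℝ)..R, G (planeMk (ξ, c r 1)) ^ 2 := by
    refine (hc.continuous_deriv_coord 1).abs.mul
      (intervalIntegral.continuous_parametric_intervalIntegral_of_continuous
      (f := fun r ξ => G (planeMk (ξ, c r 1)) ^ 2) ?_ continuous_const)
    exact (hGm.comp (continuous_snd.prodMk ((hc.continuous_coord 1).comp continuous_fst))).pow 2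
  have hnn : ∀ z, 0 ≤ ∫ ξ in (0 : ℝ)..R, G (planeMk (ξ, z)) ^ 2 := fun z =>
    intervalIntegral.integral_nonneg hR fun _ _ => sq_nonneg _
  rw [← ENNReal.ofReal_le_ofReal_iff (by positivity), intervalIntegral.integral_of_le hst,
    ofReal_integral_eq_lintegral_ofReal hcont.integrableOn_Ioc
      (Eventually.of_forall fun r => mul_nonneg (abs_nonneg _) (hnn _))]
  calc ∫⁻ r in Set.Ioc s t, ENNReal.ofReal (|deriv (fun u => c u 1) r| *
        ∫ ξ in (0 : ℝ)..R, G (planeMk (ξ, c r 1)) ^ 2)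
      ≤ ∫⁻ r, ‖deriv (fun u => c u 1) r‖ₑ * ∫⁻ ξ, ‖G (planeMk (ξ, c r 1))‖ₑ ^ 2 := by
        refine (setLIntegral_le_lintegral _ _).trans (lintegral_mono fun r => ?_)
        dsimp only
        rw [ENNReal.ofReal_mul (abs_nonneg _), ← Real.norm_eq_abs, ofReal_norm]
        gcongr
        exact hx _
    _ ≤ M * ∫⁻ z, ∫⁻ ξ, ‖G (planeMk (ξ, z))‖ₑ ^ 2 :=
        lintegral_speed_le hc hM (g := fun z => ∫⁻ ξ, ‖G (planeMk (ξ, z))‖ₑ ^ 2)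
          hmeas.lintegral_prod_left'
    _ ≤ M * ENNReal.ofReal Q := by rw [hsw]; gcongr
    _ = ENNReal.ofReal (M * Q) := by
        rw [ENNReal.ofReal_mul (by positivity), ENNReal.ofReal_coe_nnreal]

/-- For step functions `h` with values `a k`, the `L²` norm of the smooth approximation of `ℰ_c h`
is bounded by the `L²` norm of `h`. -/
theorem IsCurve.energy_le {c : ℝ → Plane} (hc : IsCurve c) {M : ℝ≥0}
    (hM : occupation (fun u => c u 1) ≤ (M : ℝ≥0∞) • volume) {R : ℝ} (hR0 : 0 ≤ R)
    (hR : ∀ t ∈ Set.Icc (0 : ℝ) 1, |c t 0| ≤ R) {S : ℝ}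
    (hS : ∀ t, |deriv (fun u => c u 1) t| ≤ S) (K : 𝓢(Plane, ℝ)) {κ : ℝ≥0}
    (hκ : ∫⁻ x, ‖K x‖ₑ ≤ κ) {s t : ℝ} (hs : 0 ≤ s) (hst : s ≤ t) (ht : t ≤ 1) (N : ℕ) (a : ℕ → ℝ) :
    ‖∑ k ∈ Finset.range N, a k • ∫ r in (node s t N k)..(node s t N (k + 1)),
        velocity c (shiftLp K) r‖ ^ 2 ≤
      (M * κ ^ 2 + 1) * R * S * ∑ k ∈ Finset.range N, a k ^ 2 * ((t - s) / N) := by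
  have hvel := hc.continuous_velocity (continuous_shiftLp K)
  set F := ∑ k ∈ Finset.range N, a k • ∫ r in (node s t N k)..(node s t N (k + 1)),
        velocity c (shiftLp K) r with hF
  set G : Plane → ℝ := fun x => inner ℝ F (shiftLp K x) with hG
  have hGc : Continuous G := continuous_const.inner (continuous_shiftLp K)
  set y' := deriv (fun u => c u 1) with hy'
  have hy'c : Continuous y' := hc.continuous_deriv_coord 1
  set Ψ : ℝ → ℝ := fun r => ∫ ξ in (0 : ℝ)..R, G (planeMk (ξ, c r 1)) ^ 2 with hΨ
  have hGm : Continuous fun q : ℝ × ℝ => G (planeMk q) := hGc.comp continuous_planeMk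
  have hΨc : Continuous Ψ := by
    refine intervalIntegral.continuous_parametric_intervalIntegral_of_continuous
      (f := fun r ξ => G (planeMk (ξ, c r 1)) ^ 2) ?_ continuous_const
    exact (hGm.comp (continuous_snd.prodMk ((hc.continuous_coord 1).comp continuous_fst))).pow 2
  -- The weight in Young's inequality: since `M κ² ≤ L`, the term quadratic in `G` will be at most
  -- `‖F‖² / 2`. The `+ 1` keeps `L` positive.
  set L : ℝ := M * κ ^ 2 + 1 with hL
  have hL0 : 0 < L := by positivity
  have hvG : Continuous (velocity c G) := hc.continuous_velocity hGc
  -- Expanding only one copy of `F` leaves an expression linear in the coefficients, driven by `G =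
  -- K * F`, whose `L²` norm is in turn controlled by `‖F‖`.
  have hFF : ‖F‖ ^ 2 = ∑ k ∈ Finset.range N,
      ∫ r in (node s t N k)..(node s t N (k + 1)), a k * velocity c G r := by
    rw [← real_inner_self_eq_norm_sq]
    conv_lhs => rw [hF, inner_sum]
    refine Finset.sum_congr rfl fun k _ => ?_
    rw [inner_smul_right, intervalIntegral.integral_const_mul]
    congr 1
    have := (innerSL ℝ F).intervalIntegral_comp_comm (hvel.intervalIntegrable (μ := volume)
      (node s t N k) (node s t N (k + 1)))
    simp only [velocity_comp_clm c (continuous_shiftLp K)] at this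
    exact this.symm
  have hpt : ∀ r ∈ Set.Icc (0 : ℝ) 1, ∀ b : ℝ,
      b * velocity c G r ≤ S * R * L / 2 * b ^ 2 + 1 / (2 * L) * (|y' r| * Ψ r) := by
    intro r hr b
    have hcr := hc.pos r
    have hcR : c r 0 ≤ R := (le_abs_self _).trans (hR r hr)
    have hg : Continuous fun ξ => G (planeMk (ξ, c r 1)) :=
      hGm.comp (continuous_id.prodMk continuous_const)
    have h1 : |b| * |∫ ξ in (0 : ℝ)..(c r 0), G (planeMk (ξ, c r 1))| ≤
        R * L / 2 * b ^ 2 + 1 / (2 * L) * Ψ r := by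
      calc |b| * |∫ ξ in (0 : ℝ)..(c r 0), G (planeMk (ξ, c r 1))|
          ≤ |b| * ∫ ξ in (0 : ℝ)..(c r 0), |G (planeMk (ξ, c r 1))| := by
            gcongr; exact intervalIntegral.abs_integral_le_integral_abs hcr.le
        _ = ∫ ξ in (0 : ℝ)..(c r 0), |b| * |G (planeMk (ξ, c r 1))| := by
            rw [intervalIntegral.integral_const_mul]
        _ ≤ ∫ ξ in (0 : ℝ)..R, |b| * |G (planeMk (ξ, c r 1))| := by
            refine intervalIntegral.integral_mono_interval le_rfl hcr.le hcR
              (Eventually.of_forall fun _ => by positivity) ?_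
            exact (continuous_const.mul hg.abs).intervalIntegrable _ _
        _ ≤ ∫ ξ in (0 : ℝ)..R, (L / 2 * b ^ 2 + 1 / (2 * L) * G (planeMk (ξ, c r 1)) ^ 2) := by
            refine intervalIntegral.integral_mono_on hR0
              ((continuous_const.mul hg.abs).intervalIntegrable _ _)
              ((continuous_const.add (continuous_const.mul (hg.pow 2))).intervalIntegrable _ _)
              fun ξ _ => ?_
            have h2 : 0 ≤ (L * |b| - |G (planeMk (ξ, c r 1))|) ^ 2 / (2 * L) := by positivity
            have h3 : (L * |b| - |G (planeMk (ξ, c r 1))|) ^ 2 / (2 * L) =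
                L / 2 * b ^ 2 + 1 / (2 * L) * G (planeMk (ξ, c r 1)) ^ 2 -
                  |b| * |G (planeMk (ξ, c r 1))| := by
              rw [← sq_abs b, ← sq_abs (G (planeMk (ξ, c r 1)))]
              field_simp
              ring
            linarith
        _ = R * L / 2 * b ^ 2 + 1 / (2 * L) * Ψ r := by
            rw [intervalIntegral.integral_add (continuous_const.intervalIntegrable _ _)
              (Continuous.intervalIntegrable (u := fun ξ => 1 / (2 * L) *
                G (planeMk (ξ, c r 1)) ^ 2) (continuous_const.mul (hg.pow 2)) _ _),
              intervalIntegral.integral_const, intervalIntegral.integral_const_mul]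
            simp only [sub_zero, smul_eq_mul, hΨ]
            ring
    have h0 : b * velocity c G r ≤
        |y' r| * (|b| * |∫ ξ in (0 : ℝ)..(c r 0), G (planeMk (ξ, c r 1))|) := by
      refine (le_abs_self _).trans (le_of_eq ?_)
      rw [velocity, smul_eq_mul, abs_mul, abs_mul]
      ring
    have h4 : |y' r| * (R * L / 2 * b ^ 2) ≤ S * (R * L / 2 * b ^ 2) :=
      mul_le_mul_of_nonneg_right (hS r) (by positivity)
    nlinarith [mul_le_mul_of_nonneg_left h1 (abs_nonneg (y' r))]
  have hsum : ‖F‖ ^ 2 ≤ S * R * L / 2 * (∑ k ∈ Finset.range N, a k ^ 2 * ((t - s) / N)) +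
      1 / (2 * L) * ∫ r in s..t, |y' r| * Ψ r := by
    -- For `N = 0` the nodes do not reach `t`, so the additivity over cells below is unavailable;
    -- the sum is empty and the bound trivial.
    rcases Nat.eq_zero_or_pos N with rfl | hN
    · have hI : 0 ≤ ∫ r in s..t, |y' r| * Ψ r :=
        intervalIntegral.integral_nonneg hst fun r _ => mul_nonneg (abs_nonneg _)
          (intervalIntegral.integral_nonneg hR0 fun _ _ => sq_nonneg _)
      rw [hFF]
      simp only [Finset.range_zero, Finset.sum_empty, mul_zero, zero_add]
      positivity
    have hyΨ : Continuous fun r => |y' r| * Ψ r := hy'c.abs.mul hΨc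
    have hadj := intervalIntegral.sum_integral_adjacent_intervals (μ := volume)
      (a := node s t N) (n := N) (f := fun r => |y' r| * Ψ r)
      fun k _ => hyΨ.intervalIntegrable _ _
    rw [node_zero, node_last s t hN.ne'] at hadj
    rw [hFF, ← hadj, Finset.mul_sum, Finset.mul_sum, ← Finset.sum_add_distrib]
    refine Finset.sum_le_sum fun k hk => ?_
    have hk : k < N := Finset.mem_range.1 hk
    calc ∫ r in (node s t N k)..(node s t N (k + 1)), a k * velocity c G r
        ≤ ∫ r in (node s t N k)..(node s t N (k + 1)),
            (S * R * L / 2 * a k ^ 2 + 1 / (2 * L) * (|y' r| * Ψ r)) := by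
          refine intervalIntegral.integral_mono_on (node_le_succ hst N k)
            ((continuous_const.mul hvG).intervalIntegrable _ _)
            ((continuous_const.add (continuous_const.mul hyΨ)).intervalIntegrable _ _)
            fun r hr => hpt r ⟨?_, ?_⟩ _
          · exact (hs.trans (le_node hst N k)).trans hr.1
          · exact (hr.2.trans (node_le hst hk)).trans ht
      _ = _ := by
          rw [intervalIntegral.integral_add (continuous_const.intervalIntegrable _ _)
            ((by fun_prop : Continuous fun r => 1 / (2 * L) *
              (|y' r| * Ψ r)).intervalIntegrable _ _), intervalIntegral.integral_const,
            intervalIntegral.integral_const_mul, node_succ_sub, smul_eq_mul]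
          ring
  have hQ : ∫⁻ x, ‖G x‖ₑ ^ 2 ≤ ENNReal.ofReal (κ ^ 2 * ‖F‖ ^ 2) := by
    refine (lintegral_sq_inner_shiftLp_le K F).trans ?_
    rw [ENNReal.ofReal_mul (by positivity), ENNReal.ofReal_pow (by positivity),
      ENNReal.ofReal_pow (by positivity), ENNReal.ofReal_coe_nnreal, ofReal_norm]
    gcongr
  have hD := hc.integral_speed_mul_le hM hGc (by positivity) hQ hR0 hst
  -- This half of `‖F‖²` is absorbed into the left side, which turns the factor `S R L / 2` into `S
  -- R L`.
  have hfin : 1 / (2 * L) * (∫ r in s..t, |y' r| * Ψ r) ≤ ‖F‖ ^ 2 / 2 := by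
    calc 1 / (2 * L) * (∫ r in s..t, |y' r| * Ψ r)
        ≤ 1 / (2 * L) * (M * (κ ^ 2 * ‖F‖ ^ 2)) := by gcongr
      _ ≤ 1 / (2 * L) * (L * ‖F‖ ^ 2) := by
          refine mul_le_mul_of_nonneg_left ?_ (by positivity)
          rw [← mul_assoc]
          exact mul_le_mul_of_nonneg_right (by linarith) (by positivity)
      _ = ‖F‖ ^ 2 / 2 := by field_simp
  nlinarith

/-! ### Moments of white noise -/

/-- The absolute moment of order `2m` of the standard normal law. -/
noncomputable def gaussianMoment (m : ℕ) : ℝ≥0∞ := ∫⁻ x, ‖x‖ₑ ^ (2 * m) ∂(gaussianReal 0 1)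

theorem gaussianMoment_lt_top (m : ℕ) : gaussianMoment m < ∞ := by
  rcases Nat.eq_zero_or_pos m with rfl | hm
  · simp [gaussianMoment]
  have h := memLp_id_gaussianReal' (μ := 0) (v := 1) ((2 * m : ℕ) : ℝ≥0∞)
    (ENNReal.natCast_ne_top _)
  have h2 := lintegral_rpow_enorm_lt_top_of_eLpNorm_lt_top (by simp; omega)
    (ENNReal.natCast_ne_top _) h.2
  simpa only [gaussianMoment, ENNReal.toReal_natCast, ENNReal.rpow_natCast, id] using h2

theorem lintegral_gaussianReal_pow (σ : ℝ) (m : ℕ) :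
    ∫⁻ x, ‖x‖ₑ ^ (2 * m) ∂(gaussianReal 0 (.mk (σ ^ 2) (sq_nonneg _))) =
      gaussianMoment m * ‖σ‖ₑ ^ (2 * m) := by
  have h := gaussianReal_map_const_mul (μ := 0) (v := 1) σ
  rw [mul_zero, mul_one] at h
  rw [← h, lintegral_map (by fun_prop) (by fun_prop), gaussianMoment,
    ← lintegral_mul_const _ (by fun_prop)]
  simp only [enorm_mul, mul_pow, mul_comm]

namespace WhiteNoise

variable {Ω V : Type*} [MeasurableSpace Ω] {P : Measure Ω} [IsProbabilityMeasure P]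
  [NormedAddCommGroup V] [InnerProductSpace ℝ V] [MeasurableSpace V] [BorelSpace V]
  [FiniteDimensional ℝ V]

/-- The component `⟨W(f), X⟩` of the white noise. -/
noncomputable def comp (W : WhiteNoise V P) (X : V) (f : Lp ℝ 2 (volume : Measure Plane))
    (ω : Ω) : ℝ := inner ℝ (W.toFun f ω) X

theorem isGaussianProcess_comp (W : WhiteNoise V P) {T : Type*} (X : T → V)
    (f : T → Lp ℝ 2 (volume : Measure Plane)) :
    IsGaussianProcess (fun t => W.comp (X t) (f t)) P := by
  have h := (W.gaussian.comp_right f).comp_left fun t => innerSL ℝ (X t)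
  refine h.congr fun t => Eventually.of_forall fun ω => ?_
  simp [comp, real_inner_comm]

theorem hasGaussianLaw_comp (W : WhiteNoise V P) (X : V) (f : Lp ℝ 2 (volume : Measure Plane)) :
    HasGaussianLaw (W.comp X f) P :=
  (W.isGaussianProcess_comp (T := Unit) (fun _ => X) (fun _ => f)).hasGaussianLaw_eval ()

theorem aemeasurable_comp (W : WhiteNoise V P) (X : V) (f : Lp ℝ 2 (volume : Measure Plane)) :
    AEMeasurable (W.comp X f) P := (W.hasGaussianLaw_comp X f).aemeasurable

theorem integral_comp (W : WhiteNoise V P) (X : V) (f : Lp ℝ 2 (volume : Measure Plane)) :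
    ∫ ω, W.comp X f ω ∂P = 0 := by
  have hi : Integrable (W.toFun f) P := (Lp.memLp (W.toFun f)).integrable (by norm_num)
  have := (innerSL ℝ X).integral_comp_comm hi
  rw [W.centered f, map_zero] at this
  rw [← this]
  refine integral_congr_ae (Eventually.of_forall fun ω => ?_)
  simp [comp, real_inner_comm]

/-- A real Gaussian law is determined by its mean and variance, which are read off from centredness
and the covariance identity. -/
theorem map_comp (W : WhiteNoise V P) {X : V} (hX : ‖X‖ = 1)
    (f : Lp ℝ 2 (volume : Measure Plane)) :
    P.map (W.comp X f) = gaussianReal 0 (.mk (‖f‖ ^ 2) (sq_nonneg _)) := by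
  have hv : Var[W.comp X f; P] = ‖f‖ ^ 2 := by
    rw [variance_of_integral_eq_zero (W.aemeasurable_comp X f) (W.integral_comp X f)]
    have := W.covariance f f X X
    rw [real_inner_self_eq_norm_sq, real_inner_self_eq_norm_sq, hX, one_pow, mul_one] at this
    simpa only [comp, sq] using this
  rw [(W.hasGaussianLaw_comp X f).map_eq_gaussianReal, W.integral_comp X f, hv]
  congr 1
  exact Real.toNNReal_of_nonneg (sq_nonneg _)

theorem lintegral_comp_pow (W : WhiteNoise V P) {X : V} (hX : ‖X‖ = 1)
    (f : Lp ℝ 2 (volume : Measure Plane)) (m : ℕ) :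
    ∫⁻ ω, ‖W.comp X f ω‖ₑ ^ (2 * m) ∂P = gaussianMoment m * ‖f‖ₑ ^ (2 * m) := by
  have h := lintegral_gaussianReal_pow ‖f‖ m
  rw [← W.map_comp hX f, lintegral_map' (by fun_prop) (W.aemeasurable_comp X f), enorm_norm] at h
  exact h

theorem comp_sum_smul (W : WhiteNoise V P) (X : V) {ι : Type*} (s : Finset ι) (x : ι → ℝ)
    (f : ι → Lp ℝ 2 (volume : Measure Plane)) :
    W.comp X (∑ k ∈ s, x k • f k) =ᵐ[P] fun ω => ∑ k ∈ s, x k * W.comp X (f k) ω := by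
  have h1 := Lp.coeFn_fun_finsetSum s fun k => x k • W.toFun (f k)
  have h2 : ∀ᵐ ω ∂P, ∀ k ∈ s, (x k • W.toFun (f k) : Lp V 2 P) ω = x k • W.toFun (f k) ω :=
    (ae_ball_iff s.countable_toSet).2 fun k _ => Lp.coeFn_smul _ _
  filter_upwards [h1, h2] with ω h1 h2
  rw [comp, map_sum]
  simp only [map_smul]
  rw [h1, sum_inner]
  refine Finset.sum_congr rfl fun k hk => ?_
  rw [h2 k hk, inner_smul_left]
  rfl

/-- Orthogonal directions give uncorrelated components, and for jointly Gaussian families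
uncorrelated means independent. -/
theorem indepFun_comp (W : WhiteNoise V P) {X Y : V} (hXY : inner ℝ X Y = (0 : ℝ)) {S T : Type*}
    (g : S → Lp ℝ 2 (volume : Measure Plane)) (f : T → Lp ℝ 2 (volume : Measure Plane)) :
    IndepFun (fun ω s => W.comp X (g s) ω) (fun ω t => W.comp Y (f t) ω) P := by
  have hG : IsGaussianProcess (Sum.elim (fun s => W.comp X (g s)) (fun t => W.comp Y (f t))) P := by
    refine (W.isGaussianProcess_comp (Sum.elim (fun _ => X) (fun _ => Y)) (Sum.elim g f)).congr ?_
    rintro (s | t) <;> rfl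
  refine hG.indepFun_of_covariance_eq_zero (fun s => W.aemeasurable_comp X _)
    (fun t => W.aemeasurable_comp Y _) fun s t => ?_
  rw [covariance_eq_sub (W.hasGaussianLaw_comp X _).memLp_two
    (W.hasGaussianLaw_comp Y _).memLp_two, W.integral_comp, zero_mul, sub_zero]
  have := W.covariance (g s) (f t) X Y
  rw [hXY, mul_zero] at this
  exact this

/-- By independence and Fubini the `X`-components can be frozen at values `x_k`. What remains is
`W_Y(∑ x_k f_k)`, a centred Gaussian of standard deviation `‖∑ x_k f_k‖`. This converts a moment of
the bilinear sum into a moment of a random `L²` norm. -/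
theorem lintegral_sum_mul_pow (W : WhiteNoise V P) {X Y : V} (hXY : inner ℝ X Y = (0 : ℝ))
    (hY : ‖Y‖ = 1) {ι : Type*} [Fintype ι] (g f : ι → Lp ℝ 2 (volume : Measure Plane)) (m : ℕ) :
    ∫⁻ ω, ‖∑ k, W.comp X (g k) ω * W.comp Y (f k) ω‖ₑ ^ (2 * m) ∂P =
      gaussianMoment m * ∫⁻ ω, ‖∑ k, W.comp X (g k) ω • f k‖ₑ ^ (2 * m) ∂P := by
  have hA : AEMeasurable (fun ω k => W.comp X (g k) ω) P :=
    aemeasurable_pi_lambda _ fun k => W.aemeasurable_comp X _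
  have hB : AEMeasurable (fun ω k => W.comp Y (f k) ω) P :=
    aemeasurable_pi_lambda _ fun k => W.aemeasurable_comp Y _
  have hprod := (W.indepFun_comp hXY g f).map_prod_eq_prod_map_map hA hB
  have := Measure.isProbabilityMeasure_map hA
  have := Measure.isProbabilityMeasure_map hB
  have hΨ : Measurable fun q : (ι → ℝ) × (ι → ℝ) => ‖∑ k, q.1 k * q.2 k‖ₑ ^ (2 * m) := by
    fun_prop
  have hin : ∀ x : ι → ℝ, ∫⁻ y, ‖∑ k, x k * y k‖ₑ ^ (2 * m)
      ∂(P.map fun ω k => W.comp Y (f k) ω) = gaussianMoment m * ‖∑ k, x k • f k‖ₑ ^ (2 * m) := by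
    intro x
    rw [lintegral_map' (by exact (hΨ.comp measurable_prodMk_left).aemeasurable) hB, ← W.lintegral_comp_pow hY]
    refine lintegral_congr_ae ?_
    filter_upwards [W.comp_sum_smul Y Finset.univ x f] with ω hω
    rw [hω]
  calc ∫⁻ ω, ‖∑ k, W.comp X (g k) ω * W.comp Y (f k) ω‖ₑ ^ (2 * m) ∂P
      = ∫⁻ q, ‖∑ k, q.1 k * q.2 k‖ₑ ^ (2 * m)
          ∂(P.map fun ω => (fun k => W.comp X (g k) ω, fun k => W.comp Y (f k) ω)) := by
        rw [lintegral_map' hΨ.aemeasurable (hA.prodMk hB)]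
    _ = ∫⁻ x, gaussianMoment m * ‖∑ k, x k • f k‖ₑ ^ (2 * m)
          ∂(P.map fun ω k => W.comp X (g k) ω) := by
        rw [hprod, lintegral_prod _ hΨ.aemeasurable]
        exact lintegral_congr hin
    _ = _ := by
        have hc : Continuous fun x : ι → ℝ => ‖∑ k, x k • f k‖ₑ ^ (2 * m) := by fun_prop
        rw [lintegral_const_mul _ hc.measurable, lintegral_map' hc.measurable.aemeasurable hA]

/-- White noise is bounded as a linear map between `L²` spaces. -/
theorem exists_clm (W : WhiteNoise V P) :
    ∃ L : Lp ℝ 2 (volume : Measure Plane) →L[ℝ] Lp V 2 P, ∀ f, L f = W.toFun f := by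
  let e := stdOrthonormalBasis ℝ V
  -- Each direction of an orthonormal basis contributes `‖f‖²` by the covariance identity.
  have hn : ∀ f, ‖W.toFun f‖ ^ 2 = Module.finrank ℝ V * ‖f‖ ^ 2 := by
    intro f
    rw [← real_inner_self_eq_norm_sq, L2.inner_def]
    have h1 : ∀ ω, inner ℝ (W.toFun f ω) (W.toFun f ω) =
        ∑ i, (inner ℝ (W.toFun f ω) (e i) * inner ℝ (W.toFun f ω) (e i) : ℝ) := fun ω => by
      rw [← e.sum_inner_mul_inner]
      simp [real_inner_comm]
    simp only [h1]
    rw [integral_finsetSum]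
    · simp only [W.covariance, real_inner_self_eq_norm_sq, e.norm_eq_one]
      simp
    · intro i _
      have := (W.hasGaussianLaw_comp (e i) f).memLp_two.integrable_sq
      simpa only [comp, sq] using this
  refine ⟨W.toFun.mkContinuous (Real.sqrt (Module.finrank ℝ V)) fun f => ?_, fun f => rfl⟩
  rw [← Real.sqrt_sq (norm_nonneg (W.toFun f)), hn, Real.sqrt_mul (by positivity),
    Real.sqrt_sq (norm_nonneg f)]

end WhiteNoise

/-! ### The second level of the signature in coordinates -/

section Signature

variable {V : Type*} [NormedAddCommGroup V] [InnerProductSpace ℝ V] [FiniteDimensional ℝ V]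

/-- A coordinate of the second level of the signature of `x`. -/
noncomputable def secondCoord (x : ℝ → V) (e f : V) (s t : ℝ) : ℝ :=
  ∫ r in s..t, inner ℝ (deriv x r) f * inner ℝ (x r - x s) e

theorem secondLevel_eq_sum {ι : Type*} [Fintype ι] (e : OrthonormalBasis ι ℝ V) {x : ℝ → V}
    (hx : Continuous x) (hx' : Continuous (deriv x)) (s t : ℝ) :
    secondLevel x s t = ∑ q : ι × ι, secondCoord x (e q.1) (e q.2) s t • (e q.1 ⊗ₜ[ℝ] e q.2) := by
  have : CompleteSpace (V ⊗[ℝ] V) := FiniteDimensional.complete ℝ _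
  have h1 : ∀ r, (x r - x s) ⊗ₜ[ℝ] deriv x r = ∑ q : ι × ι,
      (inner ℝ (deriv x r) (e q.2) * inner ℝ (x r - x s) (e q.1) : ℝ) •
        (e q.1 ⊗ₜ[ℝ] e q.2) := fun r => by
    conv_lhs => rw [← e.sum_repr' (x r - x s), ← e.sum_repr' (deriv x r)]
    rw [TensorProduct.sum_tmul, Fintype.sum_prod_type]
    refine Finset.sum_congr rfl fun a _ => ?_
    rw [TensorProduct.tmul_sum]
    refine Finset.sum_congr rfl fun b _ => ?_
    rw [TensorProduct.smul_tmul_smul, real_inner_comm, real_inner_comm (deriv x r), mul_comm]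
  simp only [secondLevel, h1]
  rw [intervalIntegral.integral_finsetSum]
  · simp only [intervalIntegral.integral_smul_const, secondCoord]
  · intro q _
    refine Continuous.intervalIntegrable ?_ _ _
    have h : Continuous fun r => (inner ℝ (deriv x r) (e q.2) * inner ℝ (x r - x s) (e q.1) : ℝ) :=
      (hx'.inner continuous_const).mul ((hx.sub continuous_const).inner continuous_const)
    exact h.smul (continuous_const (y := e q.1 ⊗ₜ[ℝ] e q.2))

/-- The integrand is the derivative of half the squared increment. -/
theorem secondCoord_self {x : ℝ → V} (hx : Differentiable ℝ x) (hx' : Continuous (deriv x))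
    (e : V) (s t : ℝ) : secondCoord x e e s t = inner ℝ (x t - x s) e ^ 2 / 2 := by
  have hd : ∀ r, HasDerivAt (fun r => inner ℝ (x r - x s) e ^ 2 / 2 : ℝ → ℝ)
      (inner ℝ (deriv x r) e * inner ℝ (x r - x s) e) r := fun r => by
    have h1 : HasDerivAt (fun r => x r - x s) (deriv x r) r := (hx r).hasDerivAt.sub_const _
    have h2 : HasDerivAt (fun r => inner ℝ (x r - x s) e : ℝ → ℝ) (inner ℝ (deriv x r) e) r := by
      simpa using h1.inner ℝ (hasDerivAt_const r e)
    refine ((h2.pow 2).div_const 2).congr_deriv ?_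
    push_cast
    ring
  rw [secondCoord, intervalIntegral.integral_eq_sub_of_hasDerivAt fun r _ => hd r]
  · simp
  · exact ((hx'.inner continuous_const).mul
      ((hx.continuous.sub continuous_const).inner continuous_const)).intervalIntegrable _ _

/-- Left point Riemann sums of the coordinates of the second level. -/
noncomputable def secondSum (x : ℝ → V) (e f : V) (s t : ℝ) (N : ℕ) : ℝ :=
  ∑ k ∈ Finset.range N, inner ℝ (x (node s t N k) - x s) e *
    inner ℝ (x (node s t N (k + 1)) - x (node s t N k)) f

theorem tendsto_secondSum {x : ℝ → V} (hx : Differentiable ℝ x) (hx' : Continuous (deriv x))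
    (e f : V) {s t : ℝ} (hst : s ≤ t) :
    Tendsto (secondSum x e f s t) atTop (𝓝 (secondCoord x e f s t)) := by
  have h := tendsto_riemann_sum (f := fun r => (inner ℝ (x r - x s) e : ℝ))
    (g := fun r => inner ℝ (deriv x r) f) ((hx.continuous.sub continuous_const).inner
      continuous_const) (hx'.inner continuous_const) hst
  refine h.congr fun N => Finset.sum_congr rfl fun k _ => ?_
  rw [smul_eq_mul, mul_comm]
  congr 1
  have hd : ∀ r, HasDerivAt (fun r => inner ℝ (x r) f : ℝ → ℝ) (inner ℝ (deriv x r) f) r :=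
    fun r => by
      have h2 := (hx r).hasDerivAt.inner ℝ (hasDerivAt_const r f)
      simpa using h2
  rw [intervalIntegral.integral_eq_sub_of_hasDerivAt (fun r _ => hd r)
    ((hx'.inner continuous_const).intervalIntegrable _ _), inner_sub_left]

end Signature

/-! ### Paths driven by white noise -/

section Paths

variable {Ω V : Type*} [MeasurableSpace Ω] {P : Measure Ω} [IsProbabilityMeasure P]
  [NormedAddCommGroup V] [InnerProductSpace ℝ V] [MeasurableSpace V] [BorelSpace V]
  [FiniteDimensional ℝ V]

theorem WhiteNoise.continuous_approx (W : WhiteNoise V P) (ρ : DyadicGenerator) (j : ℤ) (ω : Ω) :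
    Continuous (W.approx ρ j ω) :=
  (W.dist ω).continuous.comp (continuous_reflectShift _)

theorem WhiteNoise.path_eq (W : WhiteNoise V P) (ρ : DyadicGenerator) (c : ℝ → Plane) (j : ℤ)
    (ω : Ω) : W.path ρ c j ω = fun t => ∫ r in (0 : ℝ)..t, velocity c (W.approx ρ j ω) r := by
  ext t
  simp only [WhiteNoise.path, lineIntegral, Pi.zero_apply, smul_zero, zero_add]
  rfl

theorem IsCurve.hasDerivAt_path {c : ℝ → Plane} (hc : IsCurve c) (W : WhiteNoise V P)
    (ρ : DyadicGenerator) (j : ℤ) (ω : Ω) (t : ℝ) :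
    HasDerivAt (W.path ρ c j ω) (velocity c (W.approx ρ j ω) t) t := by
  have hv := hc.continuous_velocity (W.continuous_approx ρ j ω)
  rw [W.path_eq]
  exact intervalIntegral.integral_hasDerivAt_right (hv.intervalIntegrable _ _)
    (hv.stronglyMeasurableAtFilter _ _) hv.continuousAt

theorem IsCurve.differentiable_path {c : ℝ → Plane} (hc : IsCurve c) (W : WhiteNoise V P)
    (ρ : DyadicGenerator) (j : ℤ) (ω : Ω) : Differentiable ℝ (W.path ρ c j ω) :=
  fun t => (hc.hasDerivAt_path W ρ j ω t).differentiableAt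

theorem IsCurve.continuous_deriv_path {c : ℝ → Plane} (hc : IsCurve c) (W : WhiteNoise V P)
    (ρ : DyadicGenerator) (j : ℤ) (ω : Ω) : Continuous (deriv (W.path ρ c j ω)) := by
  have : deriv (W.path ρ c j ω) = velocity c (W.approx ρ j ω) :=
    funext fun t => (hc.hasDerivAt_path W ρ j ω t).deriv
  rw [this]
  exact hc.continuous_velocity (W.continuous_approx ρ j ω)

/-- The element of `L²(ℝ²)` whose image under white noise is an increment of the path. -/
noncomputable def incr (c : ℝ → Plane) (K : 𝓢(Plane, ℝ)) (s t : ℝ) :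
    Lp ℝ 2 (volume : Measure Plane) := ∫ r in s..t, velocity c (shiftLp K) r

/-- The noise is pulled out of two pathwise integrals, along horizontal segments and then along the
parameter. Each time the pathwise integral is identified with a Bochner integral in `L²(P)`, which
commutes with the bounded operator `L`. -/
theorem IsCurve.path_sub_ae_eq {c : ℝ → Plane} (hc : IsCurve c) (W : WhiteNoise V P)
    (ρ : DyadicGenerator) (j : ℤ) {s t : ℝ} (hst : s ≤ t) :
    (fun ω => W.path ρ c j ω t - W.path ρ c j ω s) =ᵐ[P] W.toFun (incr c (ρ.kernel j) s t) := by
  obtain ⟨L, hL⟩ := W.exists_clm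
  set K := ρ.kernel j with hK
  have hsh := continuous_shiftLp K
  have hLs : Continuous fun x => L (shiftLp K x) := L.continuous.comp hsh
  have hv : ∀ ω, Continuous (velocity c (W.approx ρ j ω)) := fun ω =>
    hc.continuous_velocity (W.continuous_approx ρ j ω)
  have e1 : ∀ ω, W.path ρ c j ω t - W.path ρ c j ω s =
      ∫ r in s..t, velocity c (W.approx ρ j ω) r := fun ω => by
    rw [W.path_eq]
    exact intervalIntegral.integral_interval_sub_left ((hv ω).intervalIntegrable _ _)
      ((hv ω).intervalIntegrable _ _)
  have e2 : W.toFun (incr c K s t) = ∫ r in s..t, velocity c (fun x => L (shiftLp K x)) r := by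
    rw [← hL, incr, ← L.intervalIntegral_comp_comm
      ((hc.continuous_velocity hsh).intervalIntegrable _ _)]
    simp only [velocity_comp_clm c hsh]
  rw [e2]
  simp only [e1]
  refine integral_ae_eq_integral_Lp (u := fun r ω => velocity c (W.approx ρ j ω) r) hv
    (hc.continuous_velocity hLs) (fun r => ?_) hst
  have hpt : Continuous fun ξ : ℝ => planeMk (ξ, c r 1) :=
    continuous_planeMk.comp (continuous_id.prodMk continuous_const)
  have h1 := integral_ae_eq_integral_Lp (P := P)
    (u := fun ξ ω => W.approx ρ j ω (planeMk (ξ, c r 1)))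
    (U := fun ξ => L (shiftLp K (planeMk (ξ, c r 1))))
    (fun ω => (W.continuous_approx ρ j ω).comp hpt) (hLs.comp hpt)
    (fun ξ => by
      rw [hL]
      exact W.dist_ae_eq _) (hc.pos r).le
  filter_upwards [h1, Lp.coeFn_smul (deriv (fun u => c u 1) r)
    (∫ ξ in (0 : ℝ)..(c r 0), L (shiftLp K (planeMk (ξ, c r 1))))] with ω h1 h2
  rw [velocity, h1, velocity, h2, Pi.smul_apply]

theorem IsCurve.inner_path_sub_ae_eq {c : ℝ → Plane} (hc : IsCurve c) (W : WhiteNoise V P)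
    (ρ : DyadicGenerator) (j : ℤ) (e : V) {s t : ℝ} (hst : s ≤ t) :
    (fun ω => (inner ℝ (W.path ρ c j ω t - W.path ρ c j ω s) e : ℝ)) =ᵐ[P]
      W.comp e (incr c (ρ.kernel j) s t) := by
  filter_upwards [hc.path_sub_ae_eq W ρ j hst] with ω hω
  rw [hω]; rfl

theorem IsCurve.secondSum_ae_eq {c : ℝ → Plane} (hc : IsCurve c) (W : WhiteNoise V P)
    (ρ : DyadicGenerator) (j : ℤ) (e f : V) {s t : ℝ} (hst : s ≤ t) (N : ℕ) :
    (fun ω => secondSum (W.path ρ c j ω) e f s t N) =ᵐ[P] fun ω => ∑ k : Fin N,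
      W.comp e (incr c (ρ.kernel j) s (node s t N k)) ω *
      W.comp f (incr c (ρ.kernel j) (node s t N k) (node s t N (k + 1))) ω := by
  have h1 : ∀ k : Fin N, _ := fun k => hc.inner_path_sub_ae_eq W ρ j e (le_node hst N k)
  have h2 : ∀ k : Fin N, _ := fun k => hc.inner_path_sub_ae_eq W ρ j f (node_le_succ hst N k)
  filter_upwards [ae_all_iff.2 h1, ae_all_iff.2 h2] with ω h1 h2
  rw [secondSum, Finset.sum_range]
  exact Finset.sum_congr rfl fun k _ => by rw [h1 k, h2 k]

theorem IsCurve.aestronglyMeasurable_secondSum {c : ℝ → Plane} (hc : IsCurve c)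
    (W : WhiteNoise V P) (ρ : DyadicGenerator) (j : ℤ) (e f : V) {s t : ℝ} (hst : s ≤ t) (N : ℕ) :
    AEStronglyMeasurable (fun ω => secondSum (W.path ρ c j ω) e f s t N) P := by
  refine AEStronglyMeasurable.congr ?_ (hc.secondSum_ae_eq W ρ j e f hst N).symm
  refine Finset.aestronglyMeasurable_fun_sum _ fun k _ => ?_
  exact (W.aemeasurable_comp _ _).aestronglyMeasurable.mul
    (W.aemeasurable_comp _ _).aestronglyMeasurable

theorem IsCurve.aestronglyMeasurable_secondCoord {c : ℝ → Plane} (hc : IsCurve c)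
    (W : WhiteNoise V P) (ρ : DyadicGenerator) (j : ℤ) (e f : V) {s t : ℝ} (hst : s ≤ t) :
    AEStronglyMeasurable (fun ω => secondCoord (W.path ρ c j ω) e f s t) P :=
  aestronglyMeasurable_of_tendsto_ae atTop
    (fun N => hc.aestronglyMeasurable_secondSum W ρ j e f hst N)
    (Eventually.of_forall fun ω => tendsto_secondSum (hc.differentiable_path W ρ j ω)
      (hc.continuous_deriv_path W ρ j ω) e f hst)

end Paths

/-! ### Moment estimates -/

theorem eLpNorm_le_of_lintegral_pow_le {α E : Type*} [MeasurableSpace α] {μ : Measure α}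
    [NormedAddCommGroup E] {f : α → E} {q : ℕ} (hq : q ≠ 0) {D d : ℝ≥0∞}
    (h : ∫⁻ x, ‖f x‖ₑ ^ q ∂μ ≤ D * d ^ q) :
    eLpNorm f (q : ℝ≥0∞) μ ≤ D ^ (1 / (q : ℝ)) * d := by
  have hq' : (0 : ℝ) < q := by positivity
  rw [eLpNorm_eq_lintegral_rpow_enorm_toReal (by exact_mod_cast hq) (ENNReal.natCast_ne_top _)]
  simp only [ENNReal.toReal_natCast, ENNReal.rpow_natCast]
  refine (ENNReal.rpow_le_rpow h (by positivity)).trans_eq ?_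
  rw [ENNReal.mul_rpow_of_nonneg _ _ (by positivity), ← ENNReal.rpow_natCast, ← ENNReal.rpow_mul,
    mul_one_div_cancel hq'.ne', ENNReal.rpow_one]

theorem ennreal_sum_pow_le {ι : Type*} (s : Finset ι) (f : ι → ℝ≥0∞) (q : ℕ) :
    (∑ i ∈ s, f i) ^ (q + 1) ≤ (s.card : ℝ≥0∞) ^ q * ∑ i ∈ s, f i ^ (q + 1) := by
  have h := ENNReal.rpow_sum_le_const_mul_sum_rpow s f (p := (q + 1 : ℕ))
    (by push_cast; linarith [Nat.cast_nonneg (α := ℝ) q])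
  have e : ((q + 1 : ℕ) : ℝ) - 1 = (q : ℕ) := by push_cast; ring
  rw [e] at h
  simpa only [ENNReal.rpow_natCast] using h

/-- The energy estimate for the family `incr c K` on `[0, 1]`. -/
def EnergyBound (c : ℝ → Plane) (K : 𝓢(Plane, ℝ)) (C : ℝ) : Prop :=
  ∀ s t : ℝ, 0 ≤ s → s ≤ t → t ≤ 1 → ∀ (N : ℕ) (a : ℕ → ℝ),
    ‖∑ k ∈ Finset.range N, a k • incr c K (node s t N k) (node s t N (k + 1))‖ ^ 2 ≤
      C * ∑ k ∈ Finset.range N, a k ^ 2 * ((t - s) / N)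

theorem EnergyBound.enorm_incr_sq_le {c : ℝ → Plane} {K : 𝓢(Plane, ℝ)} {C : ℝ}
    (h : EnergyBound c K C) (hC : 0 ≤ C) {s t : ℝ} (hs : 0 ≤ s) (hst : s ≤ t) (ht : t ≤ 1) :
    ‖incr c K s t‖ₑ ^ 2 ≤ ENNReal.ofReal C * ENNReal.ofReal (t - s) := by
  have h1 := h s t hs hst ht 1 fun _ => 1
  simp only [Finset.range_one, Finset.sum_singleton, one_smul, zero_add, node_zero,
    node_last s t one_ne_zero, one_pow, one_mul, Nat.cast_one, div_one] at h1
  rw [← ofReal_norm, ← ENNReal.ofReal_pow (norm_nonneg _), ← ENNReal.ofReal_mul hC]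
  exact ENNReal.ofReal_le_ofReal h1

theorem EnergyBound.enorm_sum_sq_le {c : ℝ → Plane} {K : 𝓢(Plane, ℝ)} {C : ℝ}
    (h : EnergyBound c K C) (hC : 0 ≤ C) {s t : ℝ} (hs : 0 ≤ s) (hst : s ≤ t) (ht : t ≤ 1)
    (N : ℕ) (a : Fin N → ℝ) :
    ‖∑ k : Fin N, a k • incr c K (node s t N k) (node s t N (k + 1))‖ₑ ^ 2 ≤
      ENNReal.ofReal C * ENNReal.ofReal ((t - s) / N) * ∑ k, ‖a k‖ₑ ^ 2 := by
  have hδ : 0 ≤ (t - s) / N := div_nonneg (by linarith) (by positivity)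
  -- Coefficients beyond the last cell never enter the sums; zero is an arbitrary extension.
  have h1 := h s t hs hst ht N fun k => if hk : k < N then a ⟨k, hk⟩ else 0
  rw [Finset.sum_range, Finset.sum_range] at h1
  simp only [Fin.is_lt, dite_true, Fin.eta] at h1
  rw [← ofReal_norm, ← ENNReal.ofReal_pow (norm_nonneg _)]
  refine (ENNReal.ofReal_le_ofReal h1).trans_eq ?_
  rw [← Finset.sum_mul, mul_comm (∑ k, a k ^ 2), ← mul_assoc, ENNReal.ofReal_mul (by positivity),
    ENNReal.ofReal_mul hC, ENNReal.ofReal_sum_of_nonneg fun _ _ => sq_nonneg _]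
  congr 1
  refine Finset.sum_congr rfl fun k _ => ?_
  rw [← sq_abs, ENNReal.ofReal_pow (abs_nonneg _), ← Real.norm_eq_abs, ofReal_norm]

section

variable {Ω V : Type*} [MeasurableSpace Ω] {P : Measure Ω} [IsProbabilityMeasure P]
  [NormedAddCommGroup V] [InnerProductSpace ℝ V] [MeasurableSpace V] [BorelSpace V]
  [FiniteDimensional ℝ V]

/-- A power `2m` of the square of a Gaussian is a moment of order `4m`, hence `gaussianMoment (2 *
m)`; the factor `1/2` is discarded. -/
theorem IsCurve.lintegral_secondCoord_self_le {c : ℝ → Plane} (hc : IsCurve c)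
    (W : WhiteNoise V P) (ρ : DyadicGenerator) (j : ℤ) {e : V} (he : ‖e‖ = 1) {C : ℝ}
    (hE : EnergyBound c (ρ.kernel j) C) (hC : 0 ≤ C) {s t : ℝ} (hs : 0 ≤ s) (hst : s ≤ t)
    (ht : t ≤ 1) (m : ℕ) :
    ∫⁻ ω, ‖secondCoord (W.path ρ c j ω) e e s t‖ₑ ^ (2 * m) ∂P ≤
      gaussianMoment (2 * m) * ENNReal.ofReal C ^ (2 * m) * ENNReal.ofReal (t - s) ^ (2 * m) := by
  have h1 : ∀ᵐ ω ∂P, ‖secondCoord (W.path ρ c j ω) e e s t‖ₑ ^ (2 * m) ≤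
      ‖W.comp e (incr c (ρ.kernel j) s t) ω‖ₑ ^ (2 * (2 * m)) := by
    filter_upwards [hc.inner_path_sub_ae_eq W ρ j e hst] with ω hω
    rw [secondCoord_self (hc.differentiable_path W ρ j ω) (hc.continuous_deriv_path W ρ j ω), hω,
      pow_mul _ 2 (2 * m)]
    gcongr
    rw [← enorm_pow, ← ofReal_norm, ← ofReal_norm]
    refine ENNReal.ofReal_le_ofReal ?_
    rw [norm_div, Real.norm_ofNat]
    exact half_le_self (norm_nonneg _)
  refine (lintegral_mono_ae h1).trans ?_
  rw [W.lintegral_comp_pow he, mul_assoc, ← mul_pow, pow_mul _ 2 (2 * m)]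
  gcongr
  exact hE.enorm_incr_sq_le hC hs hst ht

/-- Decoupling reduces the moment to that of `‖∑ W_e(g_k) incr_k‖`. The energy bound, applied for
each `ω` with coefficients `W_e(g_k)`, replaces it by a sum of squares, and the power mean
inequality moves the exponent onto the terms. One factor `gaussianMoment` comes from each of the two
components. -/
theorem IsCurve.lintegral_secondSum_le {c : ℝ → Plane} (hc : IsCurve c)
    (W : WhiteNoise V P) (ρ : DyadicGenerator) (j : ℤ) {e f : V} (he : ‖e‖ = 1) (hf : ‖f‖ = 1)
    (hef : inner ℝ e f = (0 : ℝ)) {C : ℝ} (hE : EnergyBound c (ρ.kernel j) C) (hC : 0 ≤ C)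
    {s t : ℝ} (hs : 0 ≤ s) (hst : s ≤ t) (ht : t ≤ 1) (q : ℕ) {N : ℕ} (hN : N ≠ 0) :
    ∫⁻ ω, ‖secondSum (W.path ρ c j ω) e f s t N‖ₑ ^ (2 * (q + 1)) ∂P ≤
      gaussianMoment (q + 1) ^ 2 * ENNReal.ofReal C ^ (2 * (q + 1)) *
        ENNReal.ofReal (t - s) ^ (2 * (q + 1)) := by
  set K := ρ.kernel j with hK
  set c₀ := ENNReal.ofReal C with hc₀
  set d := ENNReal.ofReal (t - s) with hd
  set δ := ENNReal.ofReal ((t - s) / N) with hδ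
  set γ := gaussianMoment (q + 1) with hγ
  set g : Fin N → Lp ℝ 2 (volume : Measure Plane) := fun k => incr c K s (node s t N k) with hg
  have hNδ : (N : ℝ≥0∞) * δ = d := by
    have : (N : ℝ) ≠ 0 := by exact_mod_cast hN
    rw [hδ, hd, ← ENNReal.ofReal_natCast, ← ENNReal.ofReal_mul (by positivity),
      mul_div_cancel₀ _ this]
  have e1 : ∫⁻ ω, ‖secondSum (W.path ρ c j ω) e f s t N‖ₑ ^ (2 * (q + 1)) ∂P =
      γ * ∫⁻ ω, ‖∑ k : Fin N, W.comp e (g k) ω •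
        incr c K (node s t N k) (node s t N (k + 1))‖ₑ ^ (2 * (q + 1)) ∂P := by
    rw [← W.lintegral_sum_mul_pow hef hf]
    refine lintegral_congr_ae ?_
    filter_upwards [hc.secondSum_ae_eq W ρ j e f hst N] with ω hω
    rw [hω]
  have hpt : ∀ ω, ‖∑ k : Fin N, W.comp e (g k) ω •
        incr c K (node s t N k) (node s t N (k + 1))‖ₑ ^ (2 * (q + 1)) ≤
      (c₀ * δ) ^ (q + 1) * (N : ℝ≥0∞) ^ q * ∑ k, ‖W.comp e (g k) ω‖ₑ ^ (2 * (q + 1)) := by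
    intro ω
    have h1 := hE.enorm_sum_sq_le hC hs hst ht N fun k => W.comp e (g k) ω
    have h2 := ennreal_sum_pow_le Finset.univ (fun k => ‖W.comp e (g k) ω‖ₑ ^ 2) q
    simp only [← pow_mul, Finset.card_univ, Fintype.card_fin] at h2
    rw [pow_mul]
    refine (pow_le_pow_left₀ zero_le h1 (q + 1)).trans ?_
    rw [mul_pow, mul_assoc _ ((N : ℝ≥0∞) ^ q)]
    gcongr
  have hmom : ∀ k, ∫⁻ ω, ‖W.comp e (g k) ω‖ₑ ^ (2 * (q + 1)) ∂P ≤ γ * (c₀ * d) ^ (q + 1) := by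
    intro k
    rw [W.lintegral_comp_pow he, pow_mul]
    gcongr
    have hk : node s t N k ≤ t := node_le hst k.2.le
    refine (hE.enorm_incr_sq_le hC hs (le_node hst N k) (hk.trans ht)).trans ?_
    gcongr
    exact ENNReal.ofReal_le_ofReal (by linarith)
  have hmeas : ∀ k : Fin N, AEMeasurable (fun ω => ‖W.comp e (g k) ω‖ₑ ^ (2 * (q + 1))) P :=
    fun k => (W.aemeasurable_comp e (g k)).enorm.pow_const _
  rw [e1]
  calc γ * ∫⁻ ω, ‖∑ k : Fin N, W.comp e (g k) ω •
        incr c K (node s t N k) (node s t N (k + 1))‖ₑ ^ (2 * (q + 1)) ∂P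
      ≤ γ * ∫⁻ ω, (c₀ * δ) ^ (q + 1) * (N : ℝ≥0∞) ^ q *
          ∑ k, ‖W.comp e (g k) ω‖ₑ ^ (2 * (q + 1)) ∂P := by
        gcongr with ω; exact hpt ω
    _ = γ * ((c₀ * δ) ^ (q + 1) * (N : ℝ≥0∞) ^ q *
          ∑ k, ∫⁻ ω, ‖W.comp e (g k) ω‖ₑ ^ (2 * (q + 1)) ∂P) := by
        rw [lintegral_const_mul'' _ (Finset.aemeasurable_fun_sum _ fun k _ => hmeas k),
          lintegral_finsetSum' _ fun k _ => hmeas k]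
    _ ≤ γ * ((c₀ * δ) ^ (q + 1) * (N : ℝ≥0∞) ^ q * ∑ _k : Fin N, γ * (c₀ * d) ^ (q + 1)) := by
        gcongr with k; exact hmom k
    -- The power mean inequality contributes `N ^ q` and the number of terms one more `N`. Together
    -- they cancel the mesh through `N δ = t - s`, so the bound does not depend on the partition.
    _ = γ ^ 2 * c₀ ^ (2 * (q + 1)) * (((N : ℝ≥0∞) * δ) ^ (q + 1) * d ^ (q + 1)) := by
        rw [Finset.sum_const, Finset.card_univ, Fintype.card_fin, nsmul_eq_mul]
        ring
    _ = _ := by rw [hNδ]; ring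

/-- The off-diagonal bound passes from the left point sums to their limit because it is uniform in
`N`. Adding the two moment constants covers both cases by one expression. -/
theorem IsCurve.eLpNorm_secondCoord_le {c : ℝ → Plane} (hc : IsCurve c) (W : WhiteNoise V P)
    (ρ : DyadicGenerator) (j : ℤ) {ι : Type*} [Fintype ι] (e : OrthonormalBasis ι ℝ V) (a b : ι)
    {C : ℝ} (hE : EnergyBound c (ρ.kernel j) C) (hC : 0 ≤ C) {s t : ℝ} (hs : 0 ≤ s) (hst : s ≤ t)
    (ht : t ≤ 1) (q : ℕ) :
    eLpNorm (fun ω => secondCoord (W.path ρ c j ω) (e a) (e b) s t) ((2 * (q + 1) : ℕ) : ℝ≥0∞) P ≤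
      ((gaussianMoment (2 * (q + 1)) + gaussianMoment (q + 1) ^ 2) *
        ENNReal.ofReal C ^ (2 * (q + 1))) ^ (1 / ((2 * (q + 1) : ℕ) : ℝ)) *
        ENNReal.ofReal (t - s) := by
  by_cases hab : a = b
  · subst hab
    refine eLpNorm_le_of_lintegral_pow_le (by omega) ?_
    refine (hc.lintegral_secondCoord_self_le W ρ j (e.norm_eq_one a) hE hC hs hst ht
      (q + 1)).trans ?_
    gcongr
    exact le_self_add
  · refine Lp.eLpNorm_le_of_ae_tendsto (u := atTop)
      (f := fun N ω => secondSum (W.path ρ c j ω) (e a) (e b) s t N) ?_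
      (fun N => hc.aestronglyMeasurable_secondSum W ρ j _ _ hst N)
      (Eventually.of_forall fun ω => tendsto_secondSum (hc.differentiable_path W ρ j ω)
        (hc.continuous_deriv_path W ρ j ω) _ _ hst)
    filter_upwards [eventually_ne_atTop 0] with N hN
    refine eLpNorm_le_of_lintegral_pow_le (by omega) ?_
    refine (hc.lintegral_secondSum_le W ρ j (e.norm_eq_one a) (e.norm_eq_one b)
      (e.inner_eq_zero hab) hE hC hs hst ht q hN).trans ?_
    gcongr
    exact le_add_self

theorem IsCurve.aestronglyMeasurable_secondLevel {c : ℝ → Plane} (hc : IsCurve c)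
    (W : WhiteNoise V P) (ρ : DyadicGenerator) (j : ℤ) {s t : ℝ} (hst : s ≤ t) :
    AEStronglyMeasurable (fun ω => secondLevel (W.path ρ c j ω) s t) P := by
  simp only [secondLevel_eq_sum (stdOrthonormalBasis ℝ V)
    (hc.differentiable_path W ρ j _).continuous (hc.continuous_deriv_path W ρ j _)]
  exact Finset.aestronglyMeasurable_fun_sum _ fun k _ =>
    (hc.aestronglyMeasurable_secondCoord W ρ j _ _ hst).smul_const _

/-- Tensors of unit vectors have norm one, so the triangle inequality costs only the number of
coordinates, the square of the dimension. -/
theorem IsCurve.eLpNorm_secondLevel_le {c : ℝ → Plane} (hc : IsCurve c) (W : WhiteNoise V P)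
    (ρ : DyadicGenerator) (j : ℤ) {C : ℝ} (hE : EnergyBound c (ρ.kernel j) C) (hC : 0 ≤ C)
    {s t : ℝ} (hs : 0 ≤ s) (hst : s ≤ t) (ht : t ≤ 1) (q : ℕ) :
    eLpNorm (fun ω => secondLevel (W.path ρ c j ω) s t) ((2 * (q + 1) : ℕ) : ℝ≥0∞) P ≤
      (Module.finrank ℝ V : ℝ≥0∞) ^ 2 *
        (((gaussianMoment (2 * (q + 1)) + gaussianMoment (q + 1) ^ 2) *
        ENNReal.ofReal C ^ (2 * (q + 1))) ^ (1 / ((2 * (q + 1) : ℕ) : ℝ)) *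
        ENNReal.ofReal (t - s)) := by
  have e := stdOrthonormalBasis ℝ V
  simp only [secondLevel_eq_sum e
    (hc.differentiable_path W ρ j _).continuous (hc.continuous_deriv_path W ρ j _)]
  have hm : ∀ r : Fin (Module.finrank ℝ V) × Fin (Module.finrank ℝ V), AEStronglyMeasurable
      (fun ω => secondCoord (W.path ρ c j ω) (e r.1) (e r.2) s t • (e r.1 ⊗ₜ[ℝ] e r.2)) P :=
    fun r => (hc.aestronglyMeasurable_secondCoord W ρ j _ _ hst).smul_const _
  have h1 := eLpNorm_sum_le (p := ((2 * (q + 1) : ℕ) : ℝ≥0∞)) (s := Finset.univ)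
    (fun r _ => hm r) (by exact_mod_cast (by omega : 1 ≤ 2 * (q + 1)))
  rw [Finset.sum_fn] at h1
  refine h1.trans ((Finset.sum_le_card_nsmul _ _
    (((gaussianMoment (2 * (q + 1)) + gaussianMoment (q + 1) ^ 2) *
        ENNReal.ofReal C ^ (2 * (q + 1))) ^ (1 / ((2 * (q + 1) : ℕ) : ℝ)) *
        ENNReal.ofReal (t - s)) fun r _ => ?_).trans_eq ?_)
  · refine le_trans (eLpNorm_mono_enorm (g := fun ω =>
      secondCoord (W.path ρ c j ω) (e r.1) (e r.2) s t) fun ω => ?_)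
      (hc.eLpNorm_secondCoord_le W ρ j e r.1 r.2 hE hC hs hst ht q)
    rw [enorm_smul, TensorProduct.enorm_tmul, ← ofReal_norm (e r.1), ← ofReal_norm (e r.2),
      e.norm_eq_one, e.norm_eq_one]
    simp
  · rw [Finset.card_univ, Fintype.card_prod, Fintype.card_fin, nsmul_eq_mul]
    push_cast
    ring

end

/-- The energy estimate holds uniformly in the frequency cutoff. -/
theorem IsCurve.exists_energyBound {c : ℝ → Plane} (hc : IsCurve c) (hcE : curveOpNorm c < ∞)
    (ρ : DyadicGenerator) :
    ∃ C : ℝ, 0 ≤ C ∧ ∀ j : ℤ, -1 ≤ j → EnergyBound c (ρ.kernel j) C := by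
  obtain ⟨M, hM⟩ := hc.exists_occupation_le hcE
  obtain ⟨R, hR0, hR⟩ := hc.exists_upper_bound 0
  obtain ⟨S, hS0, hS⟩ := hc.exists_speed_bound
  set κ := (∫⁻ x, ‖ρ.blockKernel (-1) x‖ₑ).toNNReal with hκ
  refine ⟨(M * κ ^ 2 + 1) * R * S, by positivity, fun j hj s t hs hst ht N a => ?_⟩
  refine hc.energy_le hM hR0.le hR hS (ρ.kernel j) (κ := κ) ?_ hs hst ht N a
  rw [hκ, ENNReal.coe_toNNReal (ρ.lintegral_blockKernel_lt_top _).ne]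
  exact ρ.lintegral_kernel_le hj

end YM2

theorem proposition9p5 (n : ℕ) (ρ : YM2.DyadicGenerator) (c : ℝ → YM2.Plane)
    (hc : YM2.IsCurve c) (hcE : YM2.curveOpNorm c < ∞) (p : ℝ≥0∞) (hp1 : 1 ≤ p) (hp : p ≠ ∞) :
    ∃ C : ℝ, 0 < C ∧
      ∀ (Ω : Type*) [MeasurableSpace Ω] (P : Measure Ω) [IsProbabilityMeasure P]
        (W : YM2.WhiteNoise (YM2.su n) P) (j : ℤ), -1 ≤ j →
        ∀ s t : ℝ, 0 ≤ s → s < t → t ≤ 1 →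
          MemLp (fun ω => YM2.secondLevel (W.path ρ c j ω) s t) p P ∧
          eLpNorm (fun ω => YM2.secondLevel (W.path ρ c j ω) s t) p P
            ≤ ENNReal.ofReal (C * (t - s)) := by
  obtain ⟨C, hC, hE⟩ := hc.exists_energyBound hcE ρ
  -- The estimates are for even integer exponents; `2 (q + 1)` exceeds `p`, and `L^p` norms increase
  -- with `p` on a probability space.
  obtain ⟨q, hq⟩ := ENNReal.exists_nat_gt hp
  set D : ℝ≥0∞ := (Module.finrank ℝ (YM2.su n) : ℝ≥0∞) ^ 2 *
    ((YM2.gaussianMoment (2 * (q + 1)) + YM2.gaussianMoment (q + 1) ^ 2) *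
      ENNReal.ofReal C ^ (2 * (q + 1))) ^ (1 / ((2 * (q + 1) : ℕ) : ℝ)) with hD
  have hDtop : D ≠ ∞ := by
    refine ENNReal.mul_ne_top (ENNReal.pow_ne_top (ENNReal.natCast_ne_top _))
      (ENNReal.rpow_ne_top_of_nonneg (by positivity) (ENNReal.mul_ne_top (ENNReal.add_ne_top.2
        ⟨(YM2.gaussianMoment_lt_top _).ne, ENNReal.pow_ne_top (YM2.gaussianMoment_lt_top _).ne⟩)
        (ENNReal.pow_ne_top ENNReal.ofReal_ne_top)))
  -- `D` may vanish, for instance when `su n` is trivial; the `+ 1` makes the constant positive. It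
  -- is fixed before the probability space and the noise are introduced.
  refine ⟨D.toReal + 1, by positivity, fun Ω _ P _ W j hj s t hs hst ht => ?_⟩
  have hm := hc.aestronglyMeasurable_secondLevel W ρ j hst.le
  have hle : eLpNorm (fun ω => YM2.secondLevel (W.path ρ c j ω) s t) p P
      ≤ ENNReal.ofReal ((D.toReal + 1) * (t - s)) := by
    have hpq : p ≤ ((2 * (q + 1) : ℕ) : ℝ≥0∞) :=
      hq.le.trans (by exact_mod_cast (by omega : q ≤ 2 * (q + 1)))
    refine (eLpNorm_le_eLpNorm_of_exponent_le hpq hm).trans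
      ((hc.eLpNorm_secondLevel_le W ρ j (hE j hj) hC hs hst.le ht q).trans ?_)
    rw [← mul_assoc, ← hD, ENNReal.ofReal_mul (by positivity)]
    gcongr
    rw [← ENNReal.ofReal_toReal hDtop]
    exact ENNReal.ofReal_le_ofReal (by simp)
  exact ⟨⟨hm, hle.trans_lt ENNReal.ofReal_lt_top⟩, hle⟩
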